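/- All graphs are finite and simple. For a graph $G$ let $\mathrm{mc}(G)$ be the number of edges in a largest cut of $G$, and let $\mathrm{sp}(G)=\mathrm{mc}(G)-e(G)/2$ be its surplus. For a graph $H$ and a positive integer $m$, let $\mathrm{sp}(m,H)$ be the smallest value of $\mathrm{sp}(G)$ over all graphs $G$ with $m$ edges that contain no (not necessarily induced) copy of $H$. Let $tC_{2k}$ denote the disjoint union of $t$ copies of the cycle $C_{2k}$ of length $2k$. Let $t\ge 1$ and $k\ge 2$ be integers, and let $H$ be a graph that has a vertex whose removal results in (a graph isomorphic to) $tC_{2k}$. Then \[ \mathrm{sp}(m,H)=\Omega\left(m^{4/5}\right), \] that is, there is a constant $c=c(H)>0$ with $\mathrm{sp}(m,H)\ge c\,m^{4/5}$ for all $m\ge 1$. If, moreover, $H$ contains a triangle, then this is tight: \[ \mathrm{sp}(m,H)=\Theta\left(m^{4/5}\right), \] that is, there is also a constant $C=C(H)>0$ with $\mathrm{sp}(m,H)\le C\,m^{4/5}$ for all $m\ge 1$. -/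

import Mathlib

open scoped SimpleGraph

namespace SurplusFree

/-- The size of the cut `(A, Aᶜ)`: the number of edges of `G` with exactly one endpoint in `A`. -/
noncomputable def cutSize {V : Type*} (G : SimpleGraph V) (A : Set V) : ℕ :=
  (G.between A Aᶜ).edgeSet.ncard

/-- `mc(G)`: the size of a largest cut of the finite graph `G`. -/
noncomputable def maxCut {V : Type*} [Fintype V] (G : SimpleGraph V) : ℕ :=
  (Finset.univ : Finset (Finset V)).sup fun A => cutSize G (A : Set V)

/-- The surplus `sp(G) = mc(G) - e(G) / 2`, a real number. -/
noncomputable def surplus {V : Type*} [Fintype V] (G : SimpleGraph V) : ℝ :=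
  (maxCut G : ℝ) - (G.edgeSet.ncard : ℝ) / 2

/-- The values `sp(G)` over all (finite) `H`-free graphs `G` with `m` edges; up to isomorphism the
vertex set is `Fin n`. -/
def surplusValues {W : Type*} (m : ℕ) (H : SimpleGraph W) : Set ℝ :=
  {x | ∃ (n : ℕ) (G : SimpleGraph (Fin n)), H.Free G ∧ G.edgeSet.ncard = m ∧ surplus G = x}

/-- `sp(m, H)`: the smallest value of `sp(G)` over all `H`-free graphs `G` with `m` edges. -/
noncomputable def minSurplus {W : Type*} (m : ℕ) (H : SimpleGraph W) : ℝ :=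
  sInf (surplusValues m H)

/-- The infimum defining `sp(m, H)` is attained as soon as there is an `H`-free graph with `m`
edges. -/
theorem minSurplus_isLeast {W : Type*} (m : ℕ) (H : SimpleGraph W)
    (hne : (surplusValues m H).Nonempty) :
    IsLeast (surplusValues m H) (minSurplus m H) := by
  classical
  have key : ∃ x, IsLeast (surplusValues m H) x := by
    have hex : ∃ k : ℕ, ((k : ℝ) - (m : ℝ) / 2) ∈ surplusValues m H := by
      obtain ⟨x, n, G, hG, hm, rfl⟩ := hne
      exact ⟨maxCut G, n, G, hG, hm, by rw [surplus, hm]⟩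
    refine ⟨_, Nat.find_spec hex, ?_⟩
    rintro y ⟨n, G, hG, hm, rfl⟩
    have h1 : ((maxCut G : ℝ) - (m : ℝ) / 2) ∈ surplusValues m H :=
      ⟨n, G, hG, hm, by rw [surplus, hm]⟩
    have h2 : ((Nat.find hex : ℕ) : ℝ) ≤ maxCut G := by
      exact_mod_cast Nat.find_min' hex h1
    rw [surplus, hm]
    linarith
  obtain ⟨x, hx⟩ := key
  have : minSurplus m H = x := hx.csInf_eq
  rw [this]
  exact hx

/-- `tG`: the disjoint union of `t` copies of `G`. -/
def disjointCopies {W : Type*} (t : ℕ) (G : SimpleGraph W) : SimpleGraph (Fin t × W) where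
  Adj x y := x.1 = y.1 ∧ G.Adj x.2 y.2
  symm := ⟨fun _ _ h => ⟨h.1.symm, h.2.symm⟩⟩
  loopless := ⟨fun x h => G.loopless.irrefl x.2 h.2⟩

end SurplusFree

/-! Lower bound. A neighbourhood in an `H`-free graph contains no `tC_{2k}`. This forbidden graph is
bipartite with maximum degree 2, so its Turán number is O(n^{3/2}); hence any s vertices with a
common neighbour span O(s^{3/2}) edges (`sum_adjR_le_of_free`). Attach a vector of bounded norm to
each vertex so that inner products along edges are negative on average; Gaussian rounding turns this
into surplus (`surplus_ge_of_inner_eq`). The only harmful terms are codegrees along edges, which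
count triangles and are controlled by the sparsity of neighbourhoods.

Take D of order m^{2/5}. If every induced subgraph has a vertex of degree at most D, the vectors
"vertex minus a small multiple of its back-neighbours" give surplus of order m/√D
(`surplus_ge_of_degenerate`). Otherwise some induced subgraph has minimum degree above D, and its
normalised adjacency rows, shifted by a constant, give order D² (`surplus_ge_of_dense`). Both are of
order m^{4/5}.

Upper bound. If `H` contains a triangle, triangle-free graphs are `H`-free. Over a field with q =
2^(j+1) elements, a Cayley graph on F³ generated by multiples of points of a moment curve is
triangle-free, has about q⁵/4 edges and least eigenvalue at least -3q/2, so its surplus is O(q⁴)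
(`quad_cayley_ge`). Disjoint unions of such graphs reach every m (`hasTriangleFree_rpow`). -/

open scoped SimpleGraph

namespace SurplusFree

/-! ### Cuts as values of a quadratic form -/

/-- The adjacency indicator of `G`, as a real number. -/
noncomputable def adjR {V : Type*} (G : SimpleGraph V) (u v : V) : ℝ :=
  open Classical in if G.Adj u v then 1 else 0

theorem adjR_nonneg {V : Type*} (G : SimpleGraph V) (u v : V) : 0 ≤ adjR G u v := by
  unfold adjR; split_ifs <;> norm_num

theorem adjR_le_one {V : Type*} (G : SimpleGraph V) (u v : V) : adjR G u v ≤ 1 := by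
  unfold adjR; split_ifs <;> norm_num

theorem adjR_self {V : Type*} (G : SimpleGraph V) (v : V) : adjR G v v = 0 := by
  simp [adjR]

theorem adjR_of_adj {V : Type*} {G : SimpleGraph V} {u v : V} (h : G.Adj u v) :
    adjR G u v = 1 := by simp [adjR, h]

theorem adjR_of_not_adj {V : Type*} {G : SimpleGraph V} {u v : V} (h : ¬ G.Adj u v) :
    adjR G u v = 0 := by simp [adjR, h]

theorem adjR_comm {V : Type*} (G : SimpleGraph V) (u v : V) : adjR G u v = adjR G v u := by
  by_cases h : G.Adj u v
  · rw [adjR_of_adj h, adjR_of_adj h.symm]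
  · rw [adjR_of_not_adj h, adjR_of_not_adj fun h' => h h'.symm]

/-- The quadratic form of the adjacency matrix of `G`. -/
noncomputable def quad {V : Type*} [Fintype V] (G : SimpleGraph V) (s : V → ℝ) : ℝ :=
  ∑ u, ∑ v, adjR G u v * (s u * s v)

theorem sum_adjR {V : Type*} [Fintype V] (G : SimpleGraph V) :
    ∑ u, ∑ v, adjR G u v = 2 * (G.edgeSet.ncard : ℝ) := by
  classical
  have h := G.sum_degrees_eq_twice_card_edges
  have h2 : G.edgeSet.ncard = G.edgeFinset.card := by
    rw [← SimpleGraph.coe_edgeFinset, Set.ncard_coe_finset]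
  rw [h2]
  have h3 : ∀ u, ∑ v, adjR G u v = (G.degree u : ℝ) := by
    intro u
    rw [← SimpleGraph.card_neighborFinset_eq_degree, SimpleGraph.neighborFinset_eq_filter]
    simp [adjR]
  simp_rw [h3]
  exact_mod_cast h

/-- An edge is cut exactly when `(1 - s u * s v) / 2` is 1. The form `quad` runs over ordered pairs,
whence the factor 1/4. -/
theorem cutSize_eq {V : Type*} [Fintype V] (G : SimpleGraph V) (A : Set V) (s : V → ℝ)
    (h1 : ∀ v ∈ A, s v = 1) (h2 : ∀ v ∉ A, s v = -1) :
    (cutSize G A : ℝ) = (G.edgeSet.ncard : ℝ) / 2 - quad G s / 4 := by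
  have h : ∀ u v, adjR (G.between A Aᶜ) u v = (adjR G u v - adjR G u v * (s u * s v)) / 2 := by
    intro u v
    by_cases hG : G.Adj u v
    · by_cases hu : u ∈ A <;> by_cases hv : v ∈ A <;>
        simp [adjR, SimpleGraph.between_adj, hG, hu, hv, h1, h2]
    · simp [adjR, SimpleGraph.between_adj, hG]
  have e1 := sum_adjR (G.between A Aᶜ)
  simp_rw [h, ← Finset.sum_div, Finset.sum_sub_distrib] at e1
  rw [sum_adjR] at e1
  unfold cutSize quad
  linarith

theorem surplus_ge_of_sign {V : Type*} [Fintype V] (G : SimpleGraph V) (s : V → ℝ)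
    (hs : ∀ v, s v = 1 ∨ s v = -1) : -quad G s / 4 ≤ surplus G := by
  classical
  have h := cutSize_eq G ((Finset.univ.filter fun v => s v = 1 : Finset V) : Set V) s
    (by intro v hv; simpa using hv)
    (by intro v hv; exact (hs v).resolve_left (by simpa using hv))
  have h2 : cutSize G ((Finset.univ.filter fun v => s v = 1 : Finset V) : Set V) ≤ maxCut G :=
    Finset.le_sup (f := fun A : Finset V => cutSize G (A : Set V)) (Finset.mem_univ _)
  have h3 : (cutSize G ((Finset.univ.filter fun v => s v = 1 : Finset V) : Set V) : ℝ) ≤ maxCut G :=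
    by exact_mod_cast h2
  unfold surplus
  linarith

theorem surplus_le_of_sign {V : Type*} [Fintype V] (G : SimpleGraph V) (B : ℝ)
    (hB : ∀ s : V → ℝ, (∀ v, s v = 1 ∨ s v = -1) → -quad G s / 4 ≤ B) : surplus G ≤ B := by
  classical
  obtain ⟨A, -, hA⟩ := Finset.exists_mem_eq_sup (Finset.univ : Finset (Finset V))
    Finset.univ_nonempty fun A => cutSize G (A : Set V)
  have h := cutSize_eq G (A : Set V) (fun v => if v ∈ A then 1 else -1)
    (by intro v hv; exact if_pos hv) (by intro v hv; exact if_neg hv)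
  have h2 := hB (fun v => if v ∈ A then 1 else -1) (by intro v; by_cases hv : v ∈ A <;> simp [hv])
  have h3 : maxCut G = cutSize G (A : Set V) := hA
  unfold surplus
  rw [h3]
  linarith

/-- There are no loops, so the form is affine in each single coordinate; for `|s v| ≤ 1` its value
is a convex combination of the values at `s v = 1` and `s v = -1`. -/
theorem quad_update {V : Type*} [Fintype V] [DecidableEq V] (G : SimpleGraph V) (s : V → ℝ)
    (v : V) : quad G s = (1 + s v) / 2 * quad G (Function.update s v 1) +
      (1 - s v) / 2 * quad G (Function.update s v (-1)) := by
  simp only [quad, Finset.mul_sum, ← Finset.sum_add_distrib]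
  refine Finset.sum_congr rfl fun a _ => Finset.sum_congr rfl fun b _ => ?_
  by_cases ha : a = v
  · subst ha
    by_cases hb : b = a
    · subst hb; simp [adjR_self]
    · simp [Function.update_of_ne hb]; ring
  · by_cases hb : b = v
    · subst hb; simp [Function.update_of_ne ha]; ring
    · simp [Function.update_of_ne ha, Function.update_of_ne hb]; ring

/-- Fractional cuts do not beat integral ones. -/
theorem surplus_ge_of_abs_le_one {V : Type*} [Fintype V] (G : SimpleGraph V) (s : V → ℝ)
    (hs : ∀ v, |s v| ≤ 1) : -quad G s / 4 ≤ surplus G := by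
  classical
  -- `T` contains the coordinates that may still be fractional; they are made integral one at a
  -- time.
  have key : ∀ T : Finset V, ∀ s : V → ℝ, (∀ v, |s v| ≤ 1) → (∀ v ∉ T, s v = 1 ∨ s v = -1) →
      -quad G s / 4 ≤ surplus G := by
    intro T
    induction T using Finset.induction_on with
    | empty => exact fun s _ h => surplus_ge_of_sign G s fun v => h v (by simp)
    | insert v T hv ih =>
      intro s hs h
      have h1 : ∀ r : ℝ, r = 1 ∨ r = -1 → -quad G (Function.update s v r) / 4 ≤ surplus G := by
        intro r hr
        apply ih
        · intro w
          by_cases hw : w = v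
          · subst hw; rcases hr with rfl | rfl <;> simp
          · simp [Function.update_of_ne hw, hs w]
        · intro w hwT
          by_cases hw : w = v
          · subst hw; simpa using hr
          · rw [Function.update_of_ne hw]
            exact h w (by simp [hw, hwT])
      have ha := h1 1 (Or.inl rfl)
      have hb := h1 (-1) (Or.inr rfl)
      have := abs_le.1 (hs v)
      rw [quad_update G s v]
      nlinarith
  exact key Finset.univ s hs (by simp)

/-! ### Gaussian rounding of vectors -/

section

open MeasureTheory ProbabilityTheory

/-- The standard Gaussian measure on `ℝ^ι`. -/
noncomputable def stdGauss (ι : Type*) [Fintype ι] : Measure (ι → ℝ) :=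
  Measure.pi fun _ => gaussianReal 0 1

instance {ι : Type*} [Fintype ι] : IsProbabilityMeasure (stdGauss ι) := by
  unfold stdGauss; infer_instance

theorem integrable_of_abs_le {ι : Type*} [Fintype ι] {f : (ι → ℝ) → ℝ} (hf : Continuous f)
    (C : ℝ) (h : ∀ g, |f g| ≤ C) : Integrable f (stdGauss ι) :=
  Integrable.of_bound hf.aestronglyMeasurable C (Filter.Eventually.of_forall h)

theorem integral_cos_stdGauss {ι : Type*} [Fintype ι] (z : ι → ℝ) :
    ∫ g, Real.cos (∑ i, z i * g i) ∂(stdGauss ι) = Real.exp (-(∑ i, z i ^ 2) / 2) := by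
  have h1 : ∫ g, Complex.exp ((∑ i, z i * g i : ℝ) * Complex.I) ∂(stdGauss ι) =
      Complex.exp ((-(∑ i, z i ^ 2) / 2 : ℝ)) := by
    have : ∀ g : ι → ℝ, Complex.exp ((∑ i, z i * g i : ℝ) * Complex.I) =
        ∏ i, Complex.exp (z i * g i * Complex.I) := by
      intro g
      rw [← Complex.exp_sum]
      push_cast
      rw [Finset.sum_mul]
    simp_rw [this]
    unfold stdGauss
    rw [integral_fintype_prod_eq_prod (𝕜 := ℂ)
      (f := fun i (x : ℝ) => Complex.exp (z i * x * Complex.I))]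
    have h2 : ∀ i, ∫ x : ℝ, Complex.exp (z i * x * Complex.I) ∂(gaussianReal 0 1) =
        Complex.exp (-(z i : ℂ) ^ 2 / 2) := by
      intro i
      rw [← charFun_apply_real, charFun_gaussianReal]
      congr 1
      push_cast
      ring
    simp_rw [h2]
    rw [← Complex.exp_sum]
    congr 1
    push_cast
    rw [← Finset.sum_div, ← Finset.sum_neg_distrib]
  have h3 := congrArg Complex.re h1
  rw [← Complex.ofReal_exp, Complex.ofReal_re] at h3
  rw [← h3]
  have hint : Integrable (fun g : ι → ℝ => Complex.exp ((∑ i, z i * g i : ℝ) * Complex.I))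
      (stdGauss ι) := by
    refine Integrable.of_bound (Continuous.aestronglyMeasurable (by fun_prop)) 1 (Filter.Eventually.of_forall fun g => ?_)
    rw [Complex.norm_exp_ofReal_mul_I]
  have h4 := integral_re hint
  simp only [RCLike.re_eq_complex_re] at h4
  rw [← h4]
  congr 1
  ext g
  rw [Complex.exp_ofReal_mul_I_re]

/-- Rounding by the sine rather than the sign makes the correlation an explicit function of the
inner product: the product is a difference of cosines, whose means come from the Gaussian
characteristic function. -/
theorem integral_sin_mul_sin_stdGauss {ι : Type*} [Fintype ι] (x y : ι → ℝ) :
    ∫ g, Real.sin (∑ i, x i * g i) * Real.sin (∑ i, y i * g i) ∂(stdGauss ι) =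
      Real.exp (-(∑ i, x i ^ 2) / 2) * Real.exp (-(∑ i, y i ^ 2) / 2) *
        Real.sinh (∑ i, x i * y i) := by
  have h : ∀ g : ι → ℝ, Real.sin (∑ i, x i * g i) * Real.sin (∑ i, y i * g i) =
      (Real.cos (∑ i, (x i - y i) * g i) - Real.cos (∑ i, (x i + y i) * g i)) / 2 := by
    intro g
    simp only [sub_mul, add_mul, Finset.sum_sub_distrib, Finset.sum_add_distrib]
    rw [Real.cos_sub, Real.cos_add]
    ring
  simp_rw [h]
  rw [integral_div, integral_sub, integral_cos_stdGauss, integral_cos_stdGauss, Real.sinh_eq]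
  · rw [mul_div_assoc', mul_sub, ← Real.exp_add, ← Real.exp_add, ← Real.exp_add]
    congr 3
    · simp only [sub_sq, Finset.sum_add_distrib, Finset.sum_sub_distrib, mul_assoc,
        ← Finset.mul_sum]
      ring
    · simp only [add_sq, Finset.sum_add_distrib, mul_assoc, ← Finset.mul_sum]
      ring
  · exact integrable_of_abs_le (by fun_prop) 1 fun g => Real.abs_cos_le_one _
  · exact integrable_of_abs_le (by fun_prop) 1 fun g => Real.abs_cos_le_one _

/-- Random rounding of vectors of bounded norm. -/
theorem surplus_ge_of_vectors {V ι : Type*} [Fintype V] [Fintype ι] (G : SimpleGraph V)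
    (x : V → ι → ℝ) (R : ℝ) (hR : ∀ v, ∑ i, x v i ^ 2 ≤ R) :
    -(Real.exp (-R) / 4) * ∑ u, ∑ v, adjR G u v * Real.sinh (∑ i, x u i * x v i) ≤ surplus G := by
  -- The exponential weight cancels the norm factors in the correlation of the sines, leaving `exp
  -- (-R) * sinh ⟨x u, x v⟩`, and `hR` makes it at most 1. So `s g` is a fractional cut, and
  -- averaging over `g` gives the bound.
  set s : (ι → ℝ) → V → ℝ := fun g v =>
    Real.exp ((∑ i, x v i ^ 2) / 2 - R / 2) * Real.sin (∑ i, x v i * g i) with hs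
  have hs1 : ∀ g v, |s g v| ≤ 1 := by
    intro g v
    rw [hs]
    simp only [abs_mul, Real.abs_exp]
    have := hR v
    exact mul_le_one₀ (Real.exp_le_one_iff.2 (by linarith)) (abs_nonneg _) (Real.abs_sin_le_one _)
  have hcont : ∀ v, Continuous fun g => s g v := by intro v; rw [hs]; fun_prop
  have hint : ∀ u v, Integrable (fun g => s g u * s g v) (stdGauss ι) := by
    intro u v
    refine integrable_of_abs_le ((hcont u).mul (hcont v)) 1 fun g => ?_
    rw [abs_mul]
    exact mul_le_one₀ (hs1 g u) (abs_nonneg _) (hs1 g v)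
  have hval : ∀ u v, ∫ g, s g u * s g v ∂(stdGauss ι) =
      Real.exp (-R) * Real.sinh (∑ i, x u i * x v i) := by
    intro u v
    have : ∀ g, s g u * s g v = (Real.exp ((∑ i, x u i ^ 2) / 2 - R / 2) *
        Real.exp ((∑ i, x v i ^ 2) / 2 - R / 2)) *
        (Real.sin (∑ i, x u i * g i) * Real.sin (∑ i, x v i * g i)) := by
      intro g; rw [hs]; ring
    simp_rw [this]
    rw [integral_const_mul, integral_sin_mul_sin_stdGauss, ← mul_assoc, ← Real.exp_add,
      ← Real.exp_add, ← Real.exp_add]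
    congr 2
    ring
  have hq : ∫ g, -quad G (s g) / 4 ∂(stdGauss ι) =
      -(Real.exp (-R) / 4) * ∑ u, ∑ v, adjR G u v * Real.sinh (∑ i, x u i * x v i) := by
    unfold quad
    rw [integral_div, integral_neg, integral_finsetSum]
    · simp_rw [fun u => integral_finsetSum (μ := stdGauss ι) Finset.univ
        (f := fun v g => adjR G u v * (s g u * s g v)) fun v _ => (hint u v).const_mul _,
        integral_const_mul, hval]
      have : ∀ u v, adjR G u v * (Real.exp (-R) * Real.sinh (∑ i, x u i * x v i)) =
          Real.exp (-R) * (adjR G u v * Real.sinh (∑ i, x u i * x v i)) := by intros; ring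
      simp_rw [this, ← Finset.mul_sum]
      ring
    · exact fun u _ => integrable_finsetSum _ fun v _ => (hint u v).const_mul _
  rw [← hq]
  have hle : ∀ g, -quad G (s g) / 4 ≤ surplus G := fun g => surplus_ge_of_abs_le_one G _ (hs1 g)
  have hI : Integrable (fun g => -quad G (s g) / 4) (stdGauss ι) := by
    unfold quad
    exact ((integrable_finsetSum _ fun u _ => integrable_finsetSum _ fun v _ =>
      (hint u v).const_mul _).neg).div_const _
  calc ∫ g, -quad G (s g) / 4 ∂(stdGauss ι) ≤ ∫ _, surplus G ∂(stdGauss ι) :=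
        integral_mono hI (integrable_const _) hle
    _ = surplus G := by simp

/-- The negative part `a` must keep coefficient 1, while the error `b` may lose a constant. For
negative arguments sinh z ≤ z; for positive ones the mean value theorem gives sinh z ≤ z cosh z. -/
theorem sinh_le_of_abs_le {a b R : ℝ} (ha : 0 ≤ a) (hb : 0 ≤ b) (h : |b - a| ≤ R) :
    Real.sinh (b - a) ≤ -a + Real.cosh R * b := by
  have h1 : 1 ≤ Real.cosh R := Real.one_le_cosh R
  rcases le_total (b - a) 0 with h0 | h0
  · have := Real.sinh_le_self_iff.2 h0
    nlinarith
  · have h2 : Real.sinh (b - a) ≤ (b - a) * Real.cosh R := by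
      have h3 : Real.sinh (b - a) ≤ (b - a) * Real.cosh (b - a) := by
        rcases h0.eq_or_lt with h0 | h0
        · rw [← h0]; simp
        · obtain ⟨c, hc, hc'⟩ := exists_deriv_eq_slope Real.sinh h0
            Real.continuous_sinh.continuousOn Real.differentiable_sinh.differentiableOn
          rw [Real.deriv_sinh, Real.sinh_zero, sub_zero, sub_zero, eq_div_iff h0.ne'] at hc'
          rw [← hc', mul_comm]
          apply mul_le_mul_of_nonneg_left _ h0.le
          rw [Real.cosh_le_cosh, abs_of_pos hc.1, abs_of_pos h0]
          exact hc.2.le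
      refine h3.trans (mul_le_mul_of_nonneg_left ?_ h0)
      rw [Real.cosh_le_cosh]
      exact h.trans (le_abs_self R)
    nlinarith

end

/-! ### Sparsity of neighbourhoods in `H`-free graphs -/

/-- Dependent random choice: a dense enough vertex set `S` contains a subset of size `a` all of
whose pairs have at least `b` common neighbours in `S`. -/
theorem exists_subset_common_neighbors {V : Type*} (G : SimpleGraph V) (S : Finset V)
    (hS : S.Nonempty) (a b : ℕ)
    (h : (S.card : ℝ) ^ 3 * (a + b ^ 2) ≤ (∑ u ∈ S, ∑ v ∈ S, adjR G u v) ^ 2) :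
    ∃ U ⊆ S, a ≤ U.card ∧ ∀ u ∈ U, ∀ v ∈ U, u ≠ v →
      (b : ℝ) ≤ ∑ w ∈ S, adjR G u w * adjR G v w := by
  classical
  set cod : V → V → ℝ := fun u v => ∑ w ∈ S, adjR G u w * adjR G v w with hcod
  have hcod0 : ∀ u v, 0 ≤ cod u v := fun u v =>
    Finset.sum_nonneg fun w _ => mul_nonneg (adjR_nonneg _ _ _) (adjR_nonneg _ _ _)
  set bad : V → V → ℝ := fun u v => if u ≠ v ∧ cod u v < b then 1 else 0 with hbad
  have hn : (0 : ℝ) < S.card := by exact_mod_cast hS.card_pos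
  -- With `U` the common neighbourhood of `x` and `y` in `S`, `f x y` is the size of `U` minus its
  -- number of bad ordered pairs. A bad pair survives for fewer than `b ^ 2` choices of `(x, y)`, so
  -- the average of `f` is at least `a`; deleting one vertex from each bad pair then finishes.
  set f : V → V → ℝ := fun x y => ∑ u ∈ S, adjR G u x * adjR G u y -
    ∑ u ∈ S, ∑ v ∈ S, bad u v * ((adjR G u x * adjR G v x) * (adjR G u y * adjR G v y)) with hf
  have hsum : ∑ x ∈ S, ∑ y ∈ S, f x y =
      ∑ u ∈ S, (∑ x ∈ S, adjR G u x) ^ 2 - ∑ u ∈ S, ∑ v ∈ S, bad u v * cod u v ^ 2 := by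
    simp only [hf, Finset.sum_sub_distrib]
    congr 1
    · calc ∑ x ∈ S, ∑ y ∈ S, ∑ u ∈ S, adjR G u x * adjR G u y
          = ∑ x ∈ S, ∑ u ∈ S, ∑ y ∈ S, adjR G u x * adjR G u y :=
            Finset.sum_congr rfl fun x _ => Finset.sum_comm
        _ = ∑ u ∈ S, ∑ x ∈ S, ∑ y ∈ S, adjR G u x * adjR G u y := Finset.sum_comm
        _ = _ := Finset.sum_congr rfl fun u _ => by rw [sq, Finset.sum_mul_sum]
    · have e1 : ∀ F : V → V → V → V → ℝ, ∑ x ∈ S, ∑ y ∈ S, ∑ u ∈ S, ∑ v ∈ S, F x y u v =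
          ∑ u ∈ S, ∑ v ∈ S, ∑ x ∈ S, ∑ y ∈ S, F x y u v := by
        intro F
        calc _ = ∑ x ∈ S, ∑ u ∈ S, ∑ y ∈ S, ∑ v ∈ S, F x y u v :=
              Finset.sum_congr rfl fun x _ => Finset.sum_comm
          _ = ∑ u ∈ S, ∑ x ∈ S, ∑ y ∈ S, ∑ v ∈ S, F x y u v := Finset.sum_comm
          _ = ∑ u ∈ S, ∑ x ∈ S, ∑ v ∈ S, ∑ y ∈ S, F x y u v :=
              Finset.sum_congr rfl fun u _ => Finset.sum_congr rfl fun x _ => Finset.sum_comm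
          _ = _ := Finset.sum_congr rfl fun u _ => Finset.sum_comm
      rw [e1]
      refine Finset.sum_congr rfl fun u _ => Finset.sum_congr rfl fun v _ => ?_
      simp only [hcod]
      rw [sq, Finset.sum_mul_sum]
      simp only [Finset.mul_sum]
  have h1 : (S.card : ℝ) ^ 2 * (a + b ^ 2) ≤ ∑ u ∈ S, (∑ x ∈ S, adjR G u x) ^ 2 := by
    have hcs := sq_sum_le_card_mul_sum_sq (s := S) (f := fun u => ∑ x ∈ S, adjR G u x)
    have h2 := h.trans hcs
    refine le_of_mul_le_mul_left ?_ hn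
    calc (S.card : ℝ) * (S.card ^ 2 * (a + b ^ 2)) = S.card ^ 3 * (a + b ^ 2) := by ring
      _ ≤ _ := h2
  have h2 : ∑ u ∈ S, ∑ v ∈ S, bad u v * cod u v ^ 2 ≤ (S.card : ℝ) ^ 2 * b ^ 2 := by
    have : ∀ u ∈ S, ∀ v ∈ S, bad u v * cod u v ^ 2 ≤ (b : ℝ) ^ 2 := by
      intro u _ v _
      simp only [hbad]
      split_ifs with hb
      · rw [one_mul]; exact pow_le_pow_left₀ (hcod0 u v) hb.2.le 2
      · rw [zero_mul]; positivity
    calc _ ≤ ∑ u ∈ S, ∑ v ∈ S, (b : ℝ) ^ 2 :=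
          Finset.sum_le_sum fun u hu => Finset.sum_le_sum fun v hv => this u hu v hv
      _ = _ := by simp; ring
  obtain ⟨x, hx, y, hy, hxy⟩ : ∃ x ∈ S, ∃ y ∈ S, (a : ℝ) ≤ f x y := by
    by_contra! hc
    have : ∑ x ∈ S, ∑ y ∈ S, f x y < ∑ x ∈ S, ∑ y ∈ S, (a : ℝ) :=
      Finset.sum_lt_sum_of_nonempty hS fun x hx =>
        Finset.sum_lt_sum_of_nonempty hS fun y hy => hc x hx y hy
    simp only [Finset.sum_const, nsmul_eq_mul] at this
    nlinarith
  set U := S.filter fun u => G.Adj u x ∧ G.Adj u y with hU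
  set B := (U ×ˢ U).filter fun p => p.1 ≠ p.2 ∧ cod p.1 p.2 < b with hB
  have hUc : ∑ u ∈ S, adjR G u x * adjR G u y = U.card := by
    rw [hU, Finset.card_filter]
    push_cast
    refine Finset.sum_congr rfl fun u _ => ?_
    by_cases h1 : G.Adj u x <;> by_cases h2 : G.Adj u y <;> simp [adjR, h1, h2]
  have hBc : ∑ u ∈ S, ∑ v ∈ S, bad u v * ((adjR G u x * adjR G v x) * (adjR G u y * adjR G v y)) =
      B.card := by
    have : B = (S ×ˢ S).filter fun p => (G.Adj p.1 x ∧ G.Adj p.1 y) ∧ (G.Adj p.2 x ∧ G.Adj p.2 y) ∧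
        (p.1 ≠ p.2 ∧ cod p.1 p.2 < b) := by
      ext p
      simp only [hB, hU, Finset.mem_filter, Finset.mem_product]
      tauto
    rw [this, Finset.card_filter, Finset.sum_product]
    push_cast
    refine Finset.sum_congr rfl fun u _ => Finset.sum_congr rfl fun v _ => ?_
    by_cases h1 : G.Adj u x <;> by_cases h2 : G.Adj u y <;> by_cases h3 : G.Adj v x <;>
      by_cases h4 : G.Adj v y <;> simp [adjR, hbad, h1, h2, h3, h4]
  have hcard : a + B.card ≤ U.card := by
    have : (a : ℝ) ≤ U.card - B.card := by rw [← hUc, ← hBc]; exact hxy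
    have : (a : ℝ) + B.card ≤ U.card := by linarith
    exact_mod_cast this
  refine ⟨U \ B.image Prod.fst, fun u hu => (Finset.mem_filter.1 (Finset.mem_sdiff.1 hu).1).1,
    ?_, ?_⟩
  · have e1 := Finset.le_card_sdiff (B.image Prod.fst) U
    have e2 : (B.image Prod.fst).card ≤ B.card := Finset.card_image_le
    omega
  · intro u hu v hv huv
    by_contra! hlt
    apply (Finset.mem_sdiff.1 hu).2
    refine Finset.mem_image.2 ⟨(u, v), ?_, rfl⟩
    rw [hB, Finset.mem_filter, Finset.mem_product]
    exact ⟨⟨(Finset.mem_sdiff.1 hu).1, (Finset.mem_sdiff.1 hv).1⟩, huv, hlt⟩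

/-- Subtraction in `Fin n` is modular, so the second alternative is the edge closing the cycle. -/
theorem Fin.sub_val_eq_one {n : ℕ} {u v : Fin n} (h : (v - u).val = 1) :
    v.val = u.val + 1 ∨ (v.val = 0 ∧ u.val + 1 = n) := by
  have hu := u.2
  have hv := v.2
  rw [Fin.sub_def] at h
  simp only at h
  rcases lt_or_ge (n - u.val + v.val) n with hlt | hge
  · rw [Nat.mod_eq_of_lt hlt] at h; omega
  · rw [Nat.mod_eq_sub_mod hge, Nat.mod_eq_of_lt (by omega)] at h; omega

/-- Greedy embedding of disjoint even cycles. -/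
theorem exists_copy_disjointCopies_cycleGraph {V : Type*} (G : SimpleGraph V) (S U : Finset V)
    (hUS : U ⊆ S) (t k : ℕ) (hk : 2 ≤ k) (hU : t * k ≤ U.card)
    (hcod : ∀ u ∈ U, ∀ v ∈ U, u ≠ v →
      ((2 * (t * k) : ℕ) : ℝ) ≤ ∑ w ∈ S, adjR G u w * adjR G v w) :
    ∃ f : Fin t × Fin (2 * k) → V, Function.Injective f ∧ (∀ x, f x ∈ S) ∧
      ∀ x y, (disjointCopies t (SimpleGraph.cycleGraph (2 * k))).Adj x y → G.Adj (f x) (f y) := by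
  classical
  obtain ⟨p⟩ : Nonempty (Fin t × Fin k ↪ U) :=
    Function.Embedding.nonempty_of_card_le (by simpa using hU)
  have hk0 : 0 < k := by omega
  let nx : Fin k → Fin k := fun j => ⟨(j.val + 1) % k, Nat.mod_lt _ hk0⟩
  have hnx : ∀ j, nx j ≠ j := by
    intro j hj
    have h1 := congrArg Fin.val hj
    simp only [nx] at h1
    have := j.2
    rcases lt_or_ge (j.val + 1) k with hlt | hge
    · rw [Nat.mod_eq_of_lt hlt] at h1; omega
    · rw [Nat.mod_eq_sub_mod hge, Nat.mod_eq_of_lt (by omega)] at h1; omega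
  let P : Finset V := Finset.univ.image fun z => (p z : V)
  have hP : P.card ≤ t * k := by
    refine Finset.card_image_le.trans ?_
    simp
  -- Even positions of the cycles are the points `p z`. The odd position between two consecutive
  -- ones needs a common neighbour outside `P`; `2 * (t * k)` candidates less at most `t * k` leave
  -- enough for Hall's condition to hold trivially.
  let T : Fin t × Fin k → Finset V := fun z =>
    (S.filter fun w => G.Adj (p z) w ∧ G.Adj (p (z.1, nx z.2)) w) \ P
  have hT : ∀ z, t * k ≤ (T z).card := by
    intro z
    have hne : (p z : V) ≠ p (z.1, nx z.2) := by
      intro h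
      have h2 := congrArg Prod.snd (p.injective (Subtype.ext h))
      exact hnx z.2 h2.symm
    have h1 := hcod _ (p z).2 _ (p (z.1, nx z.2)).2 hne
    have h2 : ∑ w ∈ S, adjR G (p z) w * adjR G (p (z.1, nx z.2)) w =
        (S.filter fun w => G.Adj (p z) w ∧ G.Adj (p (z.1, nx z.2)) w).card := by
      rw [Finset.card_filter]
      push_cast
      refine Finset.sum_congr rfl fun w _ => ?_
      by_cases h1 : G.Adj (p z) w <;> by_cases h2 : G.Adj (p (z.1, nx z.2)) w <;>
        simp [adjR, h1, h2]
    rw [h2] at h1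
    have h3 := Nat.cast_le.1 h1
    have h4 := Finset.le_card_sdiff P
      (S.filter fun w => G.Adj (p z) w ∧ G.Adj (p (z.1, nx z.2)) w)
    change t * k ≤ (_ \ P).card
    omega
  obtain ⟨q, hq, hqT⟩ := (Finset.all_card_le_biUnion_card_iff_exists_injective T).1 (by
    intro s
    rcases s.eq_empty_or_nonempty with rfl | ⟨z, hz⟩
    · simp
    · calc s.card ≤ Fintype.card (Fin t × Fin k) := Finset.card_le_univ s
        _ = t * k := by simp
        _ ≤ (T z).card := hT z
        _ ≤ _ := Finset.card_le_card (Finset.subset_biUnion_of_mem T hz))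
  have hq1 : ∀ z, G.Adj (p z) (q z) ∧ G.Adj (p (z.1, nx z.2)) (q z) := fun z =>
    (Finset.mem_filter.1 (Finset.mem_sdiff.1 (hqT z)).1).2
  have hqS : ∀ z, q z ∈ S := fun z => (Finset.mem_filter.1 (Finset.mem_sdiff.1 (hqT z)).1).1
  have hqP : ∀ z z', (p z' : V) ≠ q z := fun z z' h =>
    (Finset.mem_sdiff.1 (hqT z)).2 (h ▸ Finset.mem_image_of_mem _ (Finset.mem_univ z'))
  let hf : Fin (2 * k) → Fin k := fun j => ⟨j.val / 2, by have := j.2; omega⟩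
  let f : Fin t × Fin (2 * k) → V := fun x =>
    if x.2.val % 2 = 0 then (p (x.1, hf x.2) : V) else q (x.1, hf x.2)
  have hstep : ∀ i u v, (v - u).val = 1 → G.Adj (f (i, u)) (f (i, v)) := by
    intro i u v huv
    have hu := u.2
    have hv := v.2
    by_cases hpar : u.val % 2 = 0
    · have h1 : v.val = u.val + 1 := by
        rcases Fin.sub_val_eq_one huv with h | h
        · exact h
        · omega
      have h2 : hf v = hf u := Fin.ext (by simp only [hf]; omega)
      have h3 : ¬ v.val % 2 = 0 := by omega
      simp only [f, hpar, h3, if_true, if_false, h2]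
      exact (hq1 (i, hf u)).1
    · have h3 : v.val % 2 = 0 := by
        rcases Fin.sub_val_eq_one huv with h | h <;> omega
      have h2 : hf v = nx (hf u) := by
        refine Fin.ext ?_
        simp only [hf, nx]
        rcases Fin.sub_val_eq_one huv with h | h
        · rw [Nat.mod_eq_of_lt (by omega)]; omega
        · have : u.val / 2 + 1 = k := by omega
          rw [this, Nat.mod_self, h.1]
      simp only [f, hpar, h3, if_true, if_false, h2]
      exact (hq1 (i, hf u)).2.symm
  refine ⟨f, ?_, ?_, ?_⟩
  · rintro ⟨i, u⟩ ⟨j, v⟩ h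
    simp only [f] at h
    split_ifs at h with h1 h2 h2
    · have h3 := p.injective (Subtype.ext h)
      simp only [Prod.mk.injEq, hf, Fin.mk.injEq] at h3
      exact Prod.ext h3.1 (Fin.ext (by simp only; omega))
    · exact absurd h (hqP _ _)
    · exact absurd h.symm (hqP _ _)
    · have h3 := hq h
      simp only [Prod.mk.injEq, hf, Fin.mk.injEq] at h3
      exact Prod.ext h3.1 (Fin.ext (by simp only; omega))
  · intro x
    simp only [f]
    split_ifs
    · exact hUS (p _).2
    · exact hqS _
  · rintro ⟨i, u⟩ ⟨j, v⟩ ⟨hij, h⟩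
    simp only at hij h
    subst hij
    rw [SimpleGraph.cycleGraph_adj'] at h
    rcases h with h | h
    · exact (hstep i v u h).symm
    · exact hstep i u v h

/-- In an `H`-free graph, where `H` is a cone-like extension of disjoint even cycles, sets of
vertices with a common neighbour span few edges. -/
theorem sum_adjR_le_of_free {W V : Type*} (t k : ℕ) (hk : 2 ≤ k)
    (H : SimpleGraph W) (hH : ∃ v : W, Nonempty (H.induce ({v}ᶜ : Set W) ≃g
      disjointCopies t (SimpleGraph.cycleGraph (2 * k))))
    (G : SimpleGraph V) (hG : H.Free G) (w : V) (S : Finset V) (hS : ∀ v ∈ S, G.Adj w v) :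
    ∑ u ∈ S, ∑ v ∈ S, adjR G u v ≤
      ((t * k + 1 : ℕ) * 3 : ℝ) * (S.card * Real.sqrt S.card) := by
  classical
  by_contra! hlt
  apply hG
  have hne : S.Nonempty := by
    rw [Finset.nonempty_iff_ne_empty]
    rintro rfl
    simp at hlt
  obtain ⟨U, hUS, hU, hcod⟩ := exists_subset_common_neighbors G S hne (t * k) (2 * (t * k)) (by
    have h0 : 0 ≤ ((t * k + 1 : ℕ) * 3 : ℝ) * (S.card * Real.sqrt S.card) := by positivity
    have h1 := pow_le_pow_left₀ h0 hlt.le 2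
    refine le_trans ?_ h1
    have h2 : (((t * k + 1 : ℕ) * 3 : ℝ) * (S.card * Real.sqrt S.card)) ^ 2 =
        (S.card : ℝ) ^ 3 * ((t * k + 1 : ℕ) * 3 : ℝ) ^ 2 := by
      rw [mul_pow, mul_pow (S.card : ℝ), Real.sq_sqrt (Nat.cast_nonneg _)]; ring
    rw [h2]
    refine mul_le_mul_of_nonneg_left ?_ (by positivity)
    push_cast
    have : (0 : ℝ) ≤ (t : ℝ) * k := by positivity
    nlinarith)
  obtain ⟨f, hf, hfS, hfadj⟩ := exists_copy_disjointCopies_cycleGraph G S U hUS t k hk hU hcod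
  obtain ⟨v, ⟨e⟩⟩ := hH
  -- The removed vertex of `H` goes to `w`, which is adjacent to all of `S`, so its edges are
  -- preserved whatever its neighbourhood in `H` is.
  let g : W → V := fun x => if h : x = v then w else f (e ⟨x, h⟩)
  have hgv : g v = w := by simp [g]
  have hg : ∀ x (h : x ≠ v), g x = f (e ⟨x, h⟩) := fun x h => by simp [g, h]
  have hgw : ∀ x, x ≠ v → G.Adj w (g x) := fun x h => by rw [hg x h]; exact hS _ (hfS _)
  refine ⟨⟨⟨g, ?_⟩, ?_⟩⟩
  · intro a b hab
    by_cases ha : a = v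
    · subst ha
      rw [hgv]; exact hgw b hab.ne'
    · by_cases hb : b = v
      · subst hb
        rw [hgv]; exact (hgw a ha).symm
      · rw [hg a ha, hg b hb]
        apply hfadj
        rw [e.map_adj_iff]
        exact hab
  · intro a b hab
    change g a = g b at hab
    by_cases ha : a = v
    · by_cases hb : b = v
      · rw [ha, hb]
      · exact absurd (hgw b hb) (by rw [← hab, ha, hgv]; exact G.loopless.irrefl w)
    · by_cases hb : b = v
      · exact absurd (hgw a ha) (by rw [hab, hb, hgv]; exact G.loopless.irrefl w)
      · rw [hg a ha, hg b hb] at hab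
        exact congrArg Subtype.val (e.injective (hf hab))

/-! ### Surplus of locally sparse graphs -/

/-- Here `a` is the gain and `b` the error in the inner product along an edge. The norm bound `R`
also bounds the inner products, so `sinh_le_of_abs_le` applies edge by edge. -/
theorem surplus_ge_of_inner_eq {V ι : Type*} [Fintype V] [Fintype ι] (G : SimpleGraph V)
    (x : V → ι → ℝ) (R : ℝ) (hR : ∀ v, ∑ i, x v i ^ 2 ≤ R) (a b : V → V → ℝ)
    (ha : ∀ u v, 0 ≤ a u v) (hb : ∀ u v, 0 ≤ b u v)
    (hx : ∀ u v, G.Adj u v → ∑ i, x u i * x v i = b u v - a u v) :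
    Real.exp (-R) / 4 * (∑ u, ∑ v, adjR G u v * a u v -
      Real.cosh R * ∑ u, ∑ v, adjR G u v * b u v) ≤ surplus G := by
  refine le_trans ?_ (surplus_ge_of_vectors G x R hR)
  have h1 : ∑ u, ∑ v, adjR G u v * Real.sinh (∑ i, x u i * x v i) ≤
      ∑ u, ∑ v, (Real.cosh R * (adjR G u v * b u v) - adjR G u v * a u v) := by
    refine Finset.sum_le_sum fun u _ => Finset.sum_le_sum fun v _ => ?_
    by_cases h : G.Adj u v
    · have habs : |b u v - a u v| ≤ R := by
        rw [← hx u v h]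
        have h2 : |∑ i, x u i * x v i| ≤ ∑ i, (x u i ^ 2 + x v i ^ 2) / 2 := by
          refine (Finset.abs_sum_le_sum_abs _ _).trans (Finset.sum_le_sum fun i _ => ?_)
          rw [abs_mul]
          nlinarith [sq_nonneg (|x u i| - |x v i|), sq_abs (x u i), sq_abs (x v i)]
        rw [← Finset.sum_div, Finset.sum_add_distrib] at h2
        linarith [hR u, hR v]
      have := sinh_le_of_abs_le (ha u v) (hb u v) habs
      rw [hx u v h, adjR_of_adj h]
      linarith
    · simp [adjR_of_not_adj h]
  simp only [Finset.sum_sub_distrib, ← Finset.mul_sum] at h1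
  have h2 := Real.exp_pos (-R)
  nlinarith

/-- A graph all of whose induced subgraphs have a vertex of degree at most `D` has an ordering with
back-degrees at most `D`. -/
theorem exists_rank {V : Type*} [Fintype V] (G : SimpleGraph V) (D : ℝ)
    (h : ∀ S : Finset V, S.Nonempty → ∃ v ∈ S, ∑ u ∈ S, adjR G v u ≤ D) :
    ∃ r : V → ℕ, Function.Injective r ∧
      ∀ v, ∑ u ∈ Finset.univ.filter (fun u => r u < r v), adjR G v u ≤ D := by
  classical
  have key : ∀ n : ℕ, ∀ S : Finset V, S.card = n → ∃ r : V → ℕ, Set.InjOn r S ∧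
      (∀ v ∈ S, r v < n) ∧
      ∀ v ∈ S, ∑ u ∈ S.filter (fun u => r u < r v), adjR G v u ≤ D := by
    intro n
    induction n with
    | zero =>
      intro S hS
      rw [Finset.card_eq_zero] at hS
      subst hS
      exact ⟨fun _ => 0, by simp, by simp, by simp⟩
    | succ n ih =>
      intro S hS
      obtain ⟨v, hv, hvD⟩ := h S (Finset.card_pos.1 (by omega))
      obtain ⟨r, hr1, hr2, hr3⟩ := ih (S.erase v) (by rw [Finset.card_erase_of_mem hv]; omega)
      -- The low-degree vertex comes last, so all its neighbours in `S` precede it.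
      refine ⟨Function.update r v n, ?_, ?_, ?_⟩
      · intro a ha b hb hab
        by_cases hav : a = v
        · by_cases hbv : b = v
          · rw [hav, hbv]
          · rw [hav, Function.update_self, Function.update_of_ne hbv] at hab
            have := hr2 b (Finset.mem_erase.2 ⟨hbv, hb⟩)
            omega
        · by_cases hbv : b = v
          · rw [hbv, Function.update_self, Function.update_of_ne hav] at hab
            have := hr2 a (Finset.mem_erase.2 ⟨hav, ha⟩)
            omega
          · rw [Function.update_of_ne hbv, Function.update_of_ne hav] at hab
            exact hr1 (Finset.mem_coe.2 (Finset.mem_erase.2 ⟨hav, ha⟩))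
              (Finset.mem_coe.2 (Finset.mem_erase.2 ⟨hbv, hb⟩)) hab
      · intro a ha
        by_cases hav : a = v
        · rw [hav, Function.update_self]; omega
        · rw [Function.update_of_ne hav]
          have := hr2 a (Finset.mem_erase.2 ⟨hav, ha⟩)
          omega
      · intro a ha
        by_cases hav : a = v
        · subst hav
          exact (Finset.sum_le_sum_of_subset_of_nonneg (Finset.filter_subset _ _)
            fun _ _ _ => adjR_nonneg _ _ _).trans hvD
        · refine le_trans (le_of_eq ?_) (hr3 a (Finset.mem_erase.2 ⟨hav, ha⟩))
          refine Finset.sum_congr ?_ fun _ _ => rfl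
          ext u
          simp only [Finset.mem_filter, Finset.mem_erase, Function.update_of_ne hav]
          by_cases huv : u = v
          · subst huv
            have := hr2 a (Finset.mem_erase.2 ⟨hav, ha⟩)
            simp only [Function.update_self]
            constructor
            · rintro ⟨_, h⟩; omega
            · rintro ⟨⟨h, _⟩, _⟩; exact absurd rfl h
          · simp [huv]
  obtain ⟨r, h1, -, h3⟩ := key _ Finset.univ rfl
  exact ⟨r, fun a b hab => h1 (by simp) (by simp) hab, fun v => h3 v (Finset.mem_univ v)⟩

/-- Neighbourhoods span few edges, with constant `C`. -/
def LocallySparse {V : Type*} (G : SimpleGraph V) (C : ℝ) : Prop :=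
  ∀ (w : V) (S : Finset V), (∀ v ∈ S, G.Adj w v) →
    ∑ u ∈ S, ∑ v ∈ S, adjR G u v ≤ C * (S.card * Real.sqrt S.card)

/-- In a degenerate ordering each edge has inner product `-ε` plus `ε ^ 2` times the number of
common back-neighbours. The total gain is 2εm, and `hδC` keeps the error below half of it. -/
theorem surplus_ge_of_degenerate {V : Type*} [Fintype V] (G : SimpleGraph V) (C D δ : ℝ)
    (hG : LocallySparse G C) (hC : 0 ≤ C) (hD : 0 < D) (hδ : 0 < δ) (hδ1 : δ ≤ 1)
    (hδC : Real.cosh 2 * C * δ ≤ 1 / 2)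
    (h : ∀ S : Finset V, S.Nonempty → ∃ v ∈ S, ∑ u ∈ S, adjR G v u ≤ D) :
    Real.exp (-2) / 4 * (δ / Real.sqrt D) * (G.edgeSet.ncard : ℝ) ≤ surplus G := by
  classical
  obtain ⟨r, hr, hrD⟩ := exists_rank G D h
  set N : V → Finset V := fun v => Finset.univ.filter fun u => r u < r v ∧ G.Adj v u with hN
  set n : V → V → ℝ := fun v u => if u ∈ N v then 1 else 0 with hn
  have hn0 : ∀ v u, 0 ≤ n v u := by intro v u; simp only [hn]; split_ifs <;> norm_num
  have hnsq : ∀ v u, n v u * n v u = n v u := by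
    intro v u; simp only [hn]; split_ifs <;> norm_num
  have hnself : ∀ v, n v v = 0 := by intro v; simp [hn, hN]
  have hadj : ∀ u v, adjR G u v = n v u + n u v := by
    intro u v
    by_cases hA : G.Adj u v
    · rw [adjR_of_adj hA]
      rcases lt_trichotomy (r u) (r v) with hl | he | hg
      · simp [hn, hN, hA.symm, hl, hl.le]
      · exact absurd (hr he) hA.ne
      · simp [hn, hN, hA, hg, hg.le]
    · have hA' : ¬ G.Adj v u := fun h => hA h.symm
      simp [adjR_of_not_adj hA, hn, hN, hA, hA']
  have hNcard : ∀ v, ∑ u, n v u = ((N v).card : ℝ) := by intro v; simp [hn]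
  have hND : ∀ v, ((N v).card : ℝ) ≤ D := by
    intro v
    refine le_trans (le_of_eq ?_) (hrD v)
    rw [← hNcard, Finset.sum_filter]
    refine Finset.sum_congr rfl fun u _ => ?_
    by_cases h1 : r u < r v <;> by_cases h2 : G.Adj v u <;> simp [hn, hN, adjR, h1, h2]
  have hm : ∑ v, ((N v).card : ℝ) = G.edgeSet.ncard := by
    have h1 := sum_adjR G
    simp only [hadj, Finset.sum_add_distrib, hNcard] at h1
    rw [Finset.sum_comm] at h1
    simp only [hNcard] at h1
    linarith
  have hsD : 0 < Real.sqrt D := Real.sqrt_pos.2 hD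
  set ε : ℝ := δ / Real.sqrt D with hε
  have hε0 : 0 < ε := div_pos hδ hsD
  have hεD : ε * Real.sqrt D = δ := by rw [hε]; field_simp
  have hεD2 : ε ^ 2 * D = δ ^ 2 := by
    rw [← hεD, mul_pow, Real.sq_sqrt hD.le]
  set x : V → V → ℝ := fun v i => (if i = v then 1 else 0) - ε * n v i with hx
  have hinner : ∀ u v, ∑ i, x u i * x v i =
      (if u = v then 1 else 0) - ε * n v u - ε * n u v + ε ^ 2 * ∑ i, n u i * n v i := by
    intro u v
    have : ∀ i, x u i * x v i = (if i = u then (if i = v then 1 else 0) else 0) -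
        (if i = u then ε * n v i else 0) - (if i = v then ε * n u i else 0) +
        ε ^ 2 * (n u i * n v i) := by
      intro i
      simp only [hx]
      split_ifs <;> ring
    simp only [this, Finset.sum_add_distrib, Finset.sum_sub_distrib, Finset.sum_ite_eq',
      Finset.mem_univ, if_true, Finset.mul_sum]
  have hnorm : ∀ v, ∑ i, x v i ^ 2 ≤ 2 := by
    intro v
    simp only [sq]
    rw [hinner, if_pos rfl, hnself]
    simp only [hnsq, hNcard]
    have := mul_le_mul_of_nonneg_left (hND v) (sq_nonneg ε)
    nlinarith
  have hcod0 : ∀ u v, 0 ≤ ∑ i, n u i * n v i := fun u v =>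
    Finset.sum_nonneg fun i _ => mul_nonneg (hn0 _ _) (hn0 _ _)
  have hmain := surplus_ge_of_inner_eq G x 2 hnorm (fun _ _ => ε)
    (fun u v => ε ^ 2 * ∑ i, n u i * n v i) (fun _ _ => hε0.le)
    (fun u v => mul_nonneg (sq_nonneg ε) (hcod0 u v)) (by
      intro u v huv
      rw [hinner, if_neg huv.ne]
      have := hadj u v
      rw [adjR_of_adj huv] at this
      linear_combination -ε * (-this))
  have hA : ∑ u, ∑ v, adjR G u v * ε = 2 * ε * G.edgeSet.ncard := by
    simp only [← Finset.sum_mul]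
    rw [sum_adjR]; ring
  -- A common back-neighbour of `v` and its back-neighbour `u` is an edge at `u` inside `N v`, so
  -- local sparsity of `N v` applies.
  have hloc : ∀ v, ∑ u, n v u * ∑ i, n u i * n v i ≤ C * Real.sqrt D * (N v).card := by
    intro v
    have h1 : ∑ u, n v u * ∑ i, n u i * n v i ≤ ∑ u ∈ N v, ∑ i ∈ N v, adjR G u i := by
      rw [← Finset.sum_filter_add_sum_filter_not Finset.univ (fun u => u ∈ N v)]
      have e2 : ∑ u ∈ Finset.univ.filter (fun u => u ∉ N v), n v u * ∑ i, n u i * n v i = 0 := by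
        refine Finset.sum_eq_zero fun u hu => ?_
        have : u ∉ N v := by simpa using hu
        simp [hn, this]
      rw [e2, add_zero]
      have e3 : Finset.univ.filter (fun u => u ∈ N v) = N v := by ext; simp
      rw [e3]
      refine Finset.sum_le_sum fun u hu => ?_
      have e4 : n v u = 1 := by simp [hn, hu]
      rw [e4, one_mul]
      have e5 : ∑ i ∈ N v, adjR G u i = ∑ i, adjR G u i * n v i := by
        simp [hn]
      rw [e5]
      refine Finset.sum_le_sum fun i _ => mul_le_mul_of_nonneg_right ?_ (hn0 _ _)
      rw [hadj]
      linarith [hn0 i u]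
    refine h1.trans ((hG v (N v) fun u hu => (Finset.mem_filter.1 hu).2.2).trans ?_)
    have := Real.sqrt_le_sqrt (hND v)
    calc C * ((N v).card * Real.sqrt (N v).card) ≤ C * ((N v).card * Real.sqrt D) := by gcongr
      _ = _ := by ring
  have hB : ∑ u, ∑ v, adjR G u v * (ε ^ 2 * ∑ i, n u i * n v i) ≤
      2 * (ε ^ 2 * (C * Real.sqrt D * G.edgeSet.ncard)) := by
    have e1 : ∀ u v, adjR G u v * (ε ^ 2 * ∑ i, n u i * n v i) =
        ε ^ 2 * (n v u * ∑ i, n u i * n v i) + ε ^ 2 * (n u v * ∑ i, n v i * n u i) := by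
      intro u v
      have : ∑ i, n v i * n u i = ∑ i, n u i * n v i :=
        Finset.sum_congr rfl fun i _ => mul_comm _ _
      rw [hadj, this]; ring
    simp only [e1, Finset.sum_add_distrib]
    rw [Finset.sum_comm]
    have e2 : ∑ v, ∑ u, ε ^ 2 * (n v u * ∑ i, n u i * n v i) ≤
        ε ^ 2 * (C * Real.sqrt D * G.edgeSet.ncard) := by
      simp only [← Finset.mul_sum]
      refine mul_le_mul_of_nonneg_left ?_ (sq_nonneg ε)
      rw [← hm, Finset.mul_sum]
      exact Finset.sum_le_sum fun v _ => hloc v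
    linarith
  rw [hA] at hmain
  refine le_trans ?_ hmain
  have hch : 0 < Real.cosh 2 := Real.cosh_pos 2
  have hm0 : (0 : ℝ) ≤ G.edgeSet.ncard := Nat.cast_nonneg _
  rw [mul_assoc]
  refine mul_le_mul_of_nonneg_left ?_ (by positivity)
  have h5 := mul_le_mul_of_nonneg_left hB hch.le
  have h6 : Real.cosh 2 * (2 * (ε ^ 2 * (C * Real.sqrt D * G.edgeSet.ncard))) =
      2 * (Real.cosh 2 * C * δ) * (ε * G.edgeSet.ncard) := by
    rw [← hεD]; ring
  have h7 : 0 ≤ ε * G.edgeSet.ncard := by positivity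
  nlinarith

-- The vectors are rows of the adjacency matrix of `S`, scaled to unit length and shifted by `-p` on
-- `S`. The cross terms with the shift contribute a gain of at least 2p√D per adjacent ordered pair.
-- The choice `p * S.card = δ * √D` makes the error `p ^ 2 * S.card` equal to `δ` times p√D, and
-- `hN` makes the codegree error at most half of p√D on average.
set_option maxHeartbeats 800000 in
theorem surplus_ge_of_dense {V : Type*} [Fintype V] (G : SimpleGraph V) (C D δ : ℝ)
    (hG : LocallySparse G C) (hC : 0 ≤ C) (hD : 0 < D) (hδ : 0 < δ) (hδ1 : δ ≤ 1)
    (hδC : Real.cosh 2 * δ ≤ 1 / 2) (S : Finset V) (hS : S.Nonempty)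
    (h : ∀ v ∈ S, D < ∑ u ∈ S, adjR G v u)
    (hN : 2 * Real.cosh 2 * C * S.card ≤ δ * (D * Real.sqrt D)) :
    Real.exp (-2) / 4 * (δ * D ^ 2) ≤ surplus G := by
  classical
  set d : V → ℝ := fun v => ∑ u ∈ S, adjR G v u with hd
  have hd0 : ∀ v ∈ S, 0 < d v := fun v hv => hD.trans (h v hv)
  have hsd0 : ∀ v ∈ S, 0 < Real.sqrt (d v) := fun v hv => Real.sqrt_pos.2 (hd0 v hv)
  have hn : (0 : ℝ) < S.card := by exact_mod_cast hS.card_pos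
  have hsD : 0 < Real.sqrt D := Real.sqrt_pos.2 hD
  have hDD : Real.sqrt D * Real.sqrt D = D := Real.mul_self_sqrt hD.le
  have hdd : ∀ v ∈ S, Real.sqrt (d v) * Real.sqrt (d v) = d v := fun v hv =>
    Real.mul_self_sqrt (hd0 v hv).le
  have hDn : D ≤ S.card := by
    obtain ⟨v, hv⟩ := hS
    refine (h v hv).le.trans ?_
    calc ∑ u ∈ S, adjR G v u ≤ ∑ u ∈ S, (1 : ℝ) := Finset.sum_le_sum fun u _ => adjR_le_one _ _ _
      _ = S.card := by simp
  set p : ℝ := δ * Real.sqrt D / S.card with hp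
  have hp0 : 0 ≤ p := by positivity
  have hpn : p * S.card = δ * Real.sqrt D := by rw [hp]; field_simp
  set x : V → V → ℝ := fun v i =>
    if v ∈ S then (if i ∈ S then adjR G v i / Real.sqrt (d v) - p else 0) else 0 with hx
  set cod : V → V → ℝ := fun u v => ∑ i ∈ S, adjR G u i * adjR G v i with hcod
  have hcod0 : ∀ u v, 0 ≤ cod u v := fun u v =>
    Finset.sum_nonneg fun i _ => mul_nonneg (adjR_nonneg _ _ _) (adjR_nonneg _ _ _)
  have hinner : ∀ u ∈ S, ∀ v ∈ S, ∑ i, x u i * x v i =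
      cod u v / (Real.sqrt (d u) * Real.sqrt (d v)) + p ^ 2 * S.card -
        p * (Real.sqrt (d u) + Real.sqrt (d v)) := by
    intro u hu v hv
    have e1 : ∀ i, x u i * x v i = if i ∈ S then
        (adjR G u i * adjR G v i) / (Real.sqrt (d u) * Real.sqrt (d v)) + p ^ 2 -
        p / Real.sqrt (d u) * adjR G u i - p / Real.sqrt (d v) * adjR G v i else 0 := by
      intro i
      simp only [hx, hu, hv, if_true]
      split_ifs
      · have := hsd0 u hu
        have := hsd0 v hv
        field_simp
        ring
      · simp
    simp only [e1, Finset.sum_ite_mem, Finset.univ_inter, Finset.sum_sub_distrib,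
      Finset.sum_add_distrib, ← Finset.sum_div, ← Finset.mul_sum, Finset.sum_const, nsmul_eq_mul]
    have e2 : p / Real.sqrt (d u) * d u = p * Real.sqrt (d u) := by
      rw [div_mul_eq_mul_div, div_eq_iff (hsd0 u hu).ne', mul_assoc, hdd u hu]
    have e3 : p / Real.sqrt (d v) * d v = p * Real.sqrt (d v) := by
      rw [div_mul_eq_mul_div, div_eq_iff (hsd0 v hv).ne', mul_assoc, hdd v hv]
    change cod u v / _ + _ - p / Real.sqrt (d u) * d u - p / Real.sqrt (d v) * d v = _
    rw [e2, e3]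
    ring
  have hp2n : p ^ 2 * S.card ≤ 1 := by
    have e1 : p ^ 2 * S.card * S.card = δ ^ 2 * D := by
      rw [← hDD]
      linear_combination (p * S.card + δ * Real.sqrt D) * hpn
    refine le_of_mul_le_mul_right ?_ hn
    rw [e1, one_mul]
    have : δ ^ 2 ≤ 1 := by nlinarith
    nlinarith
  have hnorm : ∀ v, ∑ i, x v i ^ 2 ≤ 2 := by
    intro v
    by_cases hv : v ∈ S
    · simp only [sq (x v _)]
      rw [hinner v hv v hv, hdd v hv]
      have e1 : cod v v = d v := by
        refine Finset.sum_congr rfl fun i _ => ?_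
        by_cases hi : G.Adj v i <;> simp [adjR, hi]
      rw [e1, div_self (hd0 v hv).ne']
      have := mul_nonneg hp0 (hsd0 v hv).le
      nlinarith
    · simp [hx, hv]
  set a : V → V → ℝ := fun u v =>
    if u ∈ S then (if v ∈ S then p * (Real.sqrt (d u) + Real.sqrt (d v)) else 0) else 0 with ha
  set b : V → V → ℝ := fun u v =>
    if u ∈ S then (if v ∈ S then cod u v / (Real.sqrt (d u) * Real.sqrt (d v)) + p ^ 2 * S.card
      else 0) else 0 with hb
  have ha0 : ∀ u v, 0 ≤ a u v := by
    intro u v; simp only [ha]; split_ifs <;> positivity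
  have hb0 : ∀ u v, 0 ≤ b u v := by
    intro u v; simp only [hb]
    have := hcod0 u v
    split_ifs <;> positivity
  have hmain := surplus_ge_of_inner_eq G x 2 hnorm a b ha0 hb0 (by
    intro u v _
    by_cases hu : u ∈ S
    · by_cases hv : v ∈ S
      · rw [hinner u hu v hv]; simp [ha, hb, hu, hv]
      · simp [ha, hb, hx, hv]
    · simp [ha, hb, hx, hu])
  have hrestrict : ∀ F : V → V → ℝ, ∑ u, ∑ v, adjR G u v *
      (if u ∈ S then (if v ∈ S then F u v else 0) else 0) =
      ∑ u ∈ S, ∑ v ∈ S, adjR G u v * F u v := by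
    intro F
    have : ∀ u v, adjR G u v * (if u ∈ S then (if v ∈ S then F u v else 0) else 0) =
        if u ∈ S then (if v ∈ S then adjR G u v * F u v else 0) else 0 := by
      intro u v; split_ifs <;> simp
    simp only [this]
    calc _ = ∑ u, if u ∈ S then ∑ v, (if v ∈ S then adjR G u v * F u v else 0) else 0 := by
          refine Finset.sum_congr rfl fun u _ => ?_
          split_ifs <;> simp
      _ = _ := by simp only [Finset.sum_ite_mem, Finset.univ_inter]
  simp only [ha, hb] at hmain
  rw [hrestrict, hrestrict] at hmain
  set M : ℝ := ∑ v ∈ S, d v with hM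
  have hMD : D * S.card ≤ M := by
    calc D * S.card = ∑ v ∈ S, D := by simp; ring
      _ ≤ M := Finset.sum_le_sum fun v hv => (h v hv).le
  have hsymm : ∀ f : V → ℝ, ∑ u ∈ S, ∑ v ∈ S, adjR G u v * f v = ∑ u ∈ S, d u * f u := by
    intro f
    rw [Finset.sum_comm]
    refine Finset.sum_congr rfl fun v _ => ?_
    rw [← Finset.sum_mul]
    congr 1
    exact Finset.sum_congr rfl fun u _ => adjR_comm _ _ _
  have hsymm' : ∀ f : V → ℝ, ∑ u ∈ S, ∑ v ∈ S, adjR G u v * f u = ∑ u ∈ S, d u * f u := by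
    intro f
    refine Finset.sum_congr rfl fun v _ => ?_
    rw [← Finset.sum_mul]
  have hA : 2 * p * Real.sqrt D * M ≤
      ∑ u ∈ S, ∑ v ∈ S, adjR G u v * (p * (Real.sqrt (d u) + Real.sqrt (d v))) := by
    have e1 : ∀ u v, adjR G u v * (p * (Real.sqrt (d u) + Real.sqrt (d v))) =
        p * (adjR G u v * Real.sqrt (d u)) + p * (adjR G u v * Real.sqrt (d v)) := by
      intros; ring
    simp only [e1, Finset.sum_add_distrib, ← Finset.mul_sum]
    rw [hsymm fun v => Real.sqrt (d v), hsymm' fun u => Real.sqrt (d u)]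
    have e3 : Real.sqrt D * M ≤ ∑ u ∈ S, d u * Real.sqrt (d u) := by
      rw [hM, Finset.mul_sum]
      refine Finset.sum_le_sum fun u hu => ?_
      rw [mul_comm]
      exact mul_le_mul_of_nonneg_left (Real.sqrt_le_sqrt (h u hu).le) (hd0 u hu).le
    nlinarith [mul_le_mul_of_nonneg_left e3 hp0]
  have hloc : ∀ u ∈ S, ∑ v ∈ S, adjR G u v * cod u v ≤ C * (d u * Real.sqrt (d u)) := by
    intro u hu
    set T := S.filter fun v => G.Adj u v with hT
    have e0 : (T.card : ℝ) = d u := by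
      rw [hT, Finset.card_filter]; push_cast
      refine Finset.sum_congr rfl fun v _ => ?_
      by_cases hv : G.Adj u v <;> simp [adjR, hv]
    have e1 : ∑ v ∈ S, adjR G u v * cod u v = ∑ v ∈ T, ∑ w ∈ T, adjR G v w := by
      rw [hT, Finset.sum_filter]
      refine Finset.sum_congr rfl fun v _ => ?_
      by_cases hv : G.Adj u v
      · rw [if_pos hv, adjR_of_adj hv, one_mul, Finset.sum_filter]
        refine Finset.sum_congr rfl fun w _ => ?_
        by_cases hw : G.Adj u w <;> simp [adjR, hw]
      · rw [if_neg hv, adjR_of_not_adj hv, zero_mul]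
    rw [e1, ← e0]
    exact hG u T fun v hv => (Finset.mem_filter.1 hv).2
  have hB : ∑ u ∈ S, ∑ v ∈ S, adjR G u v *
      (cod u v / (Real.sqrt (d u) * Real.sqrt (d v)) + p ^ 2 * S.card) ≤
      C / Real.sqrt D * M + p ^ 2 * S.card * M := by
    have e1 : ∀ u ∈ S, ∀ v ∈ S, adjR G u v *
        (cod u v / (Real.sqrt (d u) * Real.sqrt (d v)) + p ^ 2 * S.card) ≤
        (adjR G u v * cod u v) * (1 / d u / 2) + (adjR G u v * cod u v) * (1 / d v / 2) +
          adjR G u v * (p ^ 2 * S.card) := by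
      intro u hu v hv
      have h1 := hsd0 u hu
      have h2 := hsd0 v hv
      -- The AM-GM inequality decouples the two degrees, so that local sparsity can be summed around
      -- one endpoint at a time.
      have e2 : 1 / (Real.sqrt (d u) * Real.sqrt (d v)) ≤ 1 / d u / 2 + 1 / d v / 2 := by
        rw [← hdd u hu, ← hdd v hv, Real.sqrt_mul_self h1.le, Real.sqrt_mul_self h2.le]
        set α := Real.sqrt (d u)
        set β := Real.sqrt (d v)
        have : 1 / (α * α) / 2 + 1 / (β * β) / 2 - 1 / (α * β) = (1 / α - 1 / β) ^ 2 / 2 := by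
          field_simp
          ring
        nlinarith [sq_nonneg (1 / α - 1 / β)]
      have e3 := mul_le_mul_of_nonneg_left e2 (mul_nonneg (adjR_nonneg G u v) (hcod0 u v))
      calc _ = (adjR G u v * cod u v) * (1 / (Real.sqrt (d u) * Real.sqrt (d v))) +
            adjR G u v * (p ^ 2 * S.card) := by ring
        _ ≤ _ := by linarith
    refine (Finset.sum_le_sum fun u hu => Finset.sum_le_sum fun v hv => e1 u hu v hv).trans ?_
    simp only [Finset.sum_add_distrib, ← Finset.sum_mul]
    have hu1 : ∑ u ∈ S, (∑ v ∈ S, adjR G u v * cod u v) * (1 / d u / 2) ≤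
        C / Real.sqrt D * M / 2 := by
      rw [hM, Finset.mul_sum, Finset.sum_div]
      refine Finset.sum_le_sum fun u hu => ?_
      have h1 := hd0 u hu
      have h2 : Real.sqrt (d u) ≤ d u / Real.sqrt D := by
        rw [le_div_iff₀ hsD]
        nlinarith [Real.sqrt_le_sqrt (h u hu).le, hdd u hu, hsd0 u hu]
      calc _ ≤ C * (d u * Real.sqrt (d u)) * (1 / d u / 2) :=
            mul_le_mul_of_nonneg_right (hloc u hu) (by positivity)
        _ = C * Real.sqrt (d u) / 2 := by field_simp
        _ ≤ C * (d u / Real.sqrt D) / 2 := by gcongr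
        _ = _ := by ring
    have hu2 : ∑ u ∈ S, ∑ v ∈ S, adjR G u v * cod u v * (1 / d v / 2) =
        ∑ u ∈ S, (∑ v ∈ S, adjR G u v * cod u v) * (1 / d u / 2) := by
      rw [Finset.sum_comm]
      refine Finset.sum_congr rfl fun v _ => ?_
      rw [Finset.sum_mul]
      refine Finset.sum_congr rfl fun u _ => ?_
      rw [adjR_comm G u v]
      congr 2
      exact Finset.sum_congr rfl fun i _ => mul_comm _ _
    rw [hu2]
    change _ + _ + (∑ u ∈ S, d u) * _ ≤ _
    rw [← hM]
    linarith
  refine le_trans ?_ hmain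
  have hch : 0 < Real.cosh 2 := Real.cosh_pos 2
  refine mul_le_mul_of_nonneg_left ?_ (by positivity)
  have hM0 : 0 ≤ M := le_trans (by positivity) hMD
  have h1 : p ^ 2 * S.card = δ * (p * Real.sqrt D) := by linear_combination p * hpn
  have h2 : Real.cosh 2 * (C / Real.sqrt D) ≤ p * Real.sqrt D / 2 := by
    rw [hp]
    rw [mul_div_assoc', div_le_iff₀ hsD]
    have : δ * Real.sqrt D / S.card * Real.sqrt D / 2 * Real.sqrt D =
        δ * (D * Real.sqrt D) / (2 * S.card) := by
      rw [← hDD, Real.sqrt_mul_self hsD.le]; field_simp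
    rw [this, le_div_iff₀ (by positivity)]
    linarith
  have h3 : Real.cosh 2 * (C / Real.sqrt D * M + p ^ 2 * S.card * M) ≤ p * Real.sqrt D * M := by
    rw [h1]
    have hq : 0 ≤ p * Real.sqrt D := by positivity
    have h4 : Real.cosh 2 * (C / Real.sqrt D) + Real.cosh 2 * δ * (p * Real.sqrt D) ≤
        p * Real.sqrt D := by
      have := mul_le_mul_of_nonneg_right hδC hq
      linarith
    calc _ = (Real.cosh 2 * (C / Real.sqrt D) + Real.cosh 2 * δ * (p * Real.sqrt D)) * M := by ring
      _ ≤ _ := mul_le_mul_of_nonneg_right h4 hM0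
  have h5 : δ * D ^ 2 ≤ p * Real.sqrt D * M := by
    have : δ * D ^ 2 = p * Real.sqrt D * (D * S.card) := by
      have : δ * D = p * Real.sqrt D * S.card := by
        linear_combination -δ * hDD - Real.sqrt D * hpn
      linear_combination D * this
    rw [this]
    exact mul_le_mul_of_nonneg_left hMD (by positivity)
  have h6 := mul_le_mul_of_nonneg_left hB hch.le
  linarith

/-- Graphs with locally sparse neighbourhoods have surplus `Ω(m^{4/5})`. -/
theorem exists_surplus_ge_of_locallySparse (C : ℝ) (hC : 0 ≤ C) :
    ∃ c : ℝ, 0 < c ∧ ∀ (V : Type) [Fintype V] (G : SimpleGraph V), LocallySparse G C →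
      1 ≤ G.edgeSet.ncard → c * (G.edgeSet.ncard : ℝ) ^ (4 / 5 : ℝ) ≤ surplus G := by
  have hch : 1 ≤ Real.cosh 2 := Real.one_le_cosh 2
  set δ : ℝ := 1 / (2 * Real.cosh 2 * (C + 1)) with hδ
  have hden : 0 < 2 * Real.cosh 2 * (C + 1) := by positivity
  have hδ0 : 0 < δ := by positivity
  have hδe : δ * (2 * Real.cosh 2 * (C + 1)) = 1 := by rw [hδ]; field_simp
  have hδC0 : 0 ≤ δ * (Real.cosh 2 * C) := by positivity
  have hδc : Real.cosh 2 * δ ≤ 1 / 2 := by nlinarith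
  have hδCc : Real.cosh 2 * C * δ ≤ 1 / 2 := by nlinarith [mul_pos hδ0 (lt_of_lt_of_le one_pos hch)]
  have hδ1 : δ ≤ 1 := by nlinarith
  set K : ℝ := 4 * Real.cosh 2 * (C + 1) / δ with hK
  have hKδ : K * δ = 4 * Real.cosh 2 * (C + 1) := by rw [hK]; field_simp
  have hK0 : 0 < K := by positivity
  have hK1 : 1 ≤ K := by nlinarith [mul_nonneg (le_trans zero_le_one hch) hC]
  have hsK : 1 ≤ Real.sqrt K := Real.one_le_sqrt.2 hK1
  refine ⟨Real.exp (-2) / 4 * (δ / Real.sqrt K), by positivity, ?_⟩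
  intro V _ G hG hm
  set m : ℝ := (G.edgeSet.ncard : ℝ) with hm'
  have hm1 : 1 ≤ m := by rw [hm']; exact_mod_cast hm
  have hm0 : 0 < m := by linarith
  set y : ℝ := m ^ (1 / 5 : ℝ) with hy
  have hy0 : 0 < y := Real.rpow_pos_of_pos hm0 _
  have hy5 : y ^ 5 = m := by
    rw [hy, ← Real.rpow_natCast, ← Real.rpow_mul hm0.le]; norm_num
  have hy4 : m ^ (4 / 5 : ℝ) = y ^ 4 := by
    rw [hy, ← Real.rpow_natCast, ← Real.rpow_mul hm0.le]; norm_num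
  rw [hy4]
  -- This is D = K m^{2/5}, where m/√D and D² have the same order in m.
  set D : ℝ := K * y ^ 2 with hD
  have hD0 : 0 < D := by positivity
  have hsD : Real.sqrt D = Real.sqrt K * y := by
    rw [hD, Real.sqrt_mul hK0.le, Real.sqrt_sq hy0.le]
  by_cases hdeg : ∀ S : Finset V, S.Nonempty → ∃ v ∈ S, ∑ u ∈ S, adjR G v u ≤ D
  · have h1 := surplus_ge_of_degenerate G C D δ hG hC hD0 hδ0 hδ1 hδCc hdeg
    refine le_trans (le_of_eq ?_) h1
    rw [← hm', ← hy5, hsD]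
    have : Real.sqrt K ≠ 0 := by positivity
    field_simp
  · push Not at hdeg
    obtain ⟨S, hS, hSD⟩ := hdeg
    have hNm : S.card * D ≤ 2 * m := by
      calc S.card * D = ∑ v ∈ S, D := by simp
        _ ≤ ∑ v ∈ S, ∑ u ∈ S, adjR G v u := Finset.sum_le_sum fun v hv => (hSD v hv).le
        _ ≤ ∑ v ∈ S, ∑ u, adjR G v u := Finset.sum_le_sum fun v _ =>
            Finset.sum_le_sum_of_subset_of_nonneg (Finset.subset_univ _)
              fun _ _ _ => adjR_nonneg _ _ _
        _ ≤ ∑ v, ∑ u, adjR G v u :=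
            Finset.sum_le_sum_of_subset_of_nonneg (Finset.subset_univ _)
              fun _ _ _ => Finset.sum_nonneg fun _ _ => adjR_nonneg _ _ _
        _ = 2 * m := sum_adjR G
    -- Since `S.card` is at most 2m/D = 2m^{3/5}/K while D^{3/2} = K^{3/2} m^{3/5}, a large constant
    -- `K` suffices.
    have hN : 2 * Real.cosh 2 * C * S.card ≤ δ * (D * Real.sqrt D) := by
      refine le_of_mul_le_mul_right ?_ hD0
      calc 2 * Real.cosh 2 * C * S.card * D = 2 * Real.cosh 2 * C * (S.card * D) := by ring
        _ ≤ 2 * Real.cosh 2 * C * (2 * m) := by gcongr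
        _ ≤ 4 * Real.cosh 2 * (C + 1) * m := by nlinarith
        _ = δ * K * 1 * 1 * y ^ 5 := by rw [← hKδ, hy5]; ring
        _ ≤ δ * K * K * Real.sqrt K * y ^ 5 := by gcongr
        _ = δ * (D * Real.sqrt D) * D := by rw [hsD, hD]; ring
    have h1 := surplus_ge_of_dense G C D δ hG hC hD0 hδ0 hδ1 hδc S hS hSD hN
    refine le_trans ?_ h1
    rw [mul_assoc]
    refine mul_le_mul_of_nonneg_left ?_ (by positivity)
    have e1 : δ / Real.sqrt K ≤ δ := div_le_self hδ0.le hsK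
    calc δ / Real.sqrt K * y ^ 4 ≤ δ * y ^ 4 := by gcongr
      _ = δ * (1 * y ^ 2) ^ 2 := by ring
      _ ≤ δ * D ^ 2 := by rw [hD]; gcongr

/-! ### A triangle-free Cayley graph in characteristic two -/

/-- A nontrivial additive character with values `1` and `-1`. -/
structure IsSignChar {F : Type*} [Field F] (σ : F → ℝ) : Prop where
  add : ∀ x y, σ (x + y) = σ x * σ y
  sign : ∀ x, σ x = 1 ∨ σ x = -1
  nontrivial : ∃ x, σ x = -1

/-- Compose a nonzero linear functional to the field of two elements with its sign character. -/
theorem exists_isSignChar (F : Type*) [Field F] [CharP F 2] : ∃ σ : F → ℝ, IsSignChar σ := by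
  classical
  let _ : Algebra (ZMod 2) F := ZMod.algebra F 2
  obtain ⟨f, hf⟩ := Module.Projective.exists_dual_ne_zero (ZMod 2) (one_ne_zero : (1 : F) ≠ 0)
  refine ⟨fun x => if f x = 0 then 1 else -1, ?_, ?_, ⟨1, if_neg hf⟩⟩
  · intro x y
    rw [map_add]
    have hz : ∀ a : ZMod 2, a = 0 ∨ a = 1 := by decide
    have h2 : (1 : ZMod 2) + 1 = 0 := by decide
    rcases hz (f x) with hx | hx <;> rcases hz (f y) with hy | hy <;> simp [hx, hy, h2]
  · intro x
    by_cases h : f x = 0 <;> simp [h]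

section Cayley

variable {F : Type*} [Field F] {σ : F → ℝ}

theorem IsSignChar.zero (h : IsSignChar σ) : σ 0 = 1 := by
  have h1 := h.add 0 0
  rw [add_zero] at h1
  rcases h.sign 0 with h0 | h0
  · exact h0
  · rw [h0] at h1; norm_num at h1

theorem IsSignChar.sum_mul [Fintype F] [DecidableEq F] (h : IsSignChar σ) (z : F) :
    ∑ x, σ (x * z) = if z = 0 then (Fintype.card F : ℝ) else 0 := by
  split_ifs with hz
  · simp [hz, h.zero]
  · obtain ⟨x0, hx0⟩ := h.nontrivial
    have h1 : ∑ x, σ (x * z) = ∑ x, σ ((x + x0 / z) * z) :=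
      (Equiv.sum_comp (Equiv.addRight (x0 / z)) fun x => σ (x * z)).symm
    have h2 : ∀ x, σ ((x + x0 / z) * z) = -σ (x * z) := by
      intro x
      rw [add_mul, h.add, div_mul_cancel₀ x0 hz, hx0]; ring
    simp only [h2, Finset.sum_neg_distrib] at h1
    linarith

/-- The generators of the Cayley graph below. -/
def curve (p : F × F) : F × F × F := (p.1 * p.2, p.1 * p.2 ^ 2, p.1 * p.2 ^ 3)

/-- A pseudorandom triangle-free Cayley graph on `F³`. -/
def cayley [CharP F 2] (h : IsSignChar σ) : SimpleGraph (F × F × F) where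
  Adj u v := ∃ p : F × F, σ p.1 = -1 ∧ p.2 ≠ 0 ∧ v = u + curve p
  symm := ⟨fun u v ⟨p, h1, h2, h3⟩ => ⟨p, h1, h2, by
    rw [h3, add_assoc]
    have : curve p + curve p = 0 := by
      simp only [curve, Prod.mk_add_mk, CharTwo.add_self_eq_zero]; rfl
    rw [this, add_zero]⟩⟩
  loopless := ⟨fun u ⟨p, h1, h2, h3⟩ => by
    have h4 : curve p = 0 := by simpa using h3.symm
    have h5 : p.1 * p.2 = 0 := congrArg Prod.fst h4
    rcases mul_eq_zero.1 h5 with h6 | h6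
    · rw [h6, h.zero] at h1; norm_num at h1
    · exact h2 h6⟩

/-- A triangle is a relation between three generators. By a Vandermonde argument it forces equal
curve parameters `y`; then `x1 + x2 = x3`, whereas `σ` would be 1 on the left and -1 on the right.
-/
theorem cayley_triangle_free [CharP F 2] (h : IsSignChar σ) (a b c : F × F × F)
    (hab : (cayley h).Adj a b) (hbc : (cayley h).Adj b c) (hac : (cayley h).Adj a c) : False := by
  obtain ⟨⟨x1, y1⟩, hx1, hy1, rfl⟩ := hab
  obtain ⟨⟨x2, y2⟩, hx2, hy2, rfl⟩ := hbc
  obtain ⟨⟨x3, y3⟩, hx3, hy3, e⟩ := hac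
  have e' : curve (x1, y1) + curve (x2, y2) = curve (x3, y3) := by
    rw [add_assoc] at e; exact add_left_cancel e
  simp only at hx1 hx2 hx3 hy1 hy2 hy3
  simp only [curve, Prod.mk_add_mk, Prod.mk.injEq] at e'
  obtain ⟨e1, e2, e3⟩ := e'
  have hx : ∀ x, σ x = -1 → x ≠ 0 := by
    rintro x hx rfl
    rw [h.zero] at hx; norm_num at hx
  have n1 := mul_ne_zero (hx _ hx1) hy1
  have n2 := mul_ne_zero (hx _ hx2) hy2
  have n3 := mul_ne_zero (hx _ hx3) hy3
  -- The coefficients are those of (Y - y2)(Y - y3), which annihilates the other two generators.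
  have c1 : (y1 - y2) * (y1 - y3) = 0 := by
    have : x1 * y1 * ((y1 - y2) * (y1 - y3)) = 0 := by
      linear_combination e3 - (y2 + y3) * e2 + y2 * y3 * e1
    exact (mul_eq_zero.1 this).resolve_left n1
  have c2 : (y2 - y1) * (y2 - y3) = 0 := by
    have : x2 * y2 * ((y2 - y1) * (y2 - y3)) = 0 := by
      linear_combination e3 - (y1 + y3) * e2 + y1 * y3 * e1
    exact (mul_eq_zero.1 this).resolve_left n2
  have c3 : (y3 - y1) * (y3 - y2) = 0 := by
    have : x3 * y3 * ((y3 - y1) * (y3 - y2)) = 0 := by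
      linear_combination -e3 + (y1 + y2) * e2 - y1 * y2 * e1
    exact (mul_eq_zero.1 this).resolve_left n3
  have hall : y1 = y2 ∧ y1 = y3 := by
    simp only [mul_eq_zero, sub_eq_zero] at c1 c2 c3
    grind
  obtain ⟨rfl, rfl⟩ := hall
  have e4 : x1 + x2 = x3 := by
    rw [← add_mul] at e1
    exact mul_right_cancel₀ hy1 e1
  have := h.add x1 x2
  rw [e4, hx1, hx2, hx3] at this
  norm_num at this

/-- The characters of `F³`. -/
def chi (σ : F → ℝ) (w u : F × F × F) : ℝ := σ (w.1 * u.1 + w.2.1 * u.2.1 + w.2.2 * u.2.2)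

theorem chi_add (h : IsSignChar σ) (w u v : F × F × F) :
    chi σ w (u + v) = chi σ w u * chi σ w v := by
  unfold chi
  rw [← h.add]
  congr 1
  simp only [Prod.fst_add, Prod.snd_add]
  ring

section Fourier

variable [Fintype F] [DecidableEq F]

/-- The index set of the generators. -/
noncomputable def genIndex (σ : F → ℝ) : Finset (F × F) :=
  Finset.univ.filter fun p => σ p.1 = -1 ∧ p.2 ≠ 0

/-- The ratio of the second to the first coordinate recovers `y`. Thus index pairs count neighbours
without multiplicity. -/
theorem curve_injOn (h : IsSignChar σ) : Set.InjOn (curve (F := F)) (genIndex σ) := by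
  rintro ⟨x, y⟩ hp ⟨x', y'⟩ hp' e
  simp only [genIndex, Finset.coe_filter, Finset.mem_univ, true_and, Set.mem_ofPred_eq] at hp hp'
  simp only [curve, Prod.mk.injEq] at e
  have hx : x ≠ 0 := by
    rintro rfl
    rw [h.zero] at hp; norm_num at hp
  have h1 : x * y * (y - y') = 0 := by linear_combination e.2.1 - y' * e.1
  have h2 : y = y' :=
    sub_eq_zero.1 ((mul_eq_zero.1 h1).resolve_left (mul_ne_zero hx hp.2))
  subst h2
  rw [mul_right_cancel₀ hp.2 e.1]

theorem sum_adjR_cayley [CharP F 2] (h : IsSignChar σ) (u : F × F × F) (f : F × F × F → ℝ) :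
    ∑ v, adjR (cayley h) u v * f v = ∑ p ∈ genIndex σ, f (u + curve p) := by
  classical
  have h1 : ∑ v, adjR (cayley h) u v * f v =
      ∑ v ∈ (genIndex σ).image (fun p => u + curve p), f v := by
    have : ∀ v, adjR (cayley h) u v * f v =
        if v ∈ (genIndex σ).image (fun p => u + curve p) then f v else 0 := by
      intro v
      have hiff : (cayley h).Adj u v ↔ v ∈ (genIndex σ).image (fun p => u + curve p) := by
        simp only [Finset.mem_image, genIndex, Finset.mem_filter, Finset.mem_univ, true_and]
        constructor
        · rintro ⟨p, h1, h2, h3⟩; exact ⟨p, ⟨h1, h2⟩, h3.symm⟩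
        · rintro ⟨p, ⟨h1, h2⟩, h3⟩; exact ⟨p, h1, h2, h3.symm⟩
      by_cases hA : (cayley h).Adj u v
      · rw [adjR_of_adj hA, if_pos (hiff.1 hA), one_mul]
      · rw [adjR_of_not_adj hA, if_neg fun h' => hA (hiff.2 h'), zero_mul]
    simp only [this, Finset.sum_ite_mem, Finset.univ_inter]
  rw [h1, Finset.sum_image]
  intro p hp q hq e
  exact curve_injOn h hp hq (add_left_cancel e)

theorem sum_chi (h : IsSignChar σ) (u : F × F × F) :
    ∑ w, chi σ w u = if u = 0 then (Fintype.card F : ℝ) ^ 3 else 0 := by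
  have h1 : ∑ w, chi σ w u =
      (∑ x, σ (x * u.1)) * ((∑ x, σ (x * u.2.1)) * ∑ x, σ (x * u.2.2)) := by
    rw [Fintype.sum_prod_type, Finset.sum_mul]
    refine Finset.sum_congr rfl fun x _ => ?_
    rw [Fintype.sum_prod_type, Finset.sum_mul, Finset.mul_sum]
    refine Finset.sum_congr rfl fun y _ => ?_
    rw [Finset.mul_sum, Finset.mul_sum]
    refine Finset.sum_congr rfl fun z _ => ?_
    simp only [chi, h.add]
    ring
  rw [h1, h.sum_mul, h.sum_mul, h.sum_mul]
  obtain ⟨a, b, c⟩ := u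
  by_cases ha : a = 0 <;> by_cases hb : b = 0 <;> by_cases hc : c = 0 <;>
    simp [ha, hb, hc]
  ring

/-- The Fourier transform on `F³`. -/
noncomputable def hat (σ : F → ℝ) (f : F × F × F → ℝ) (w : F × F × F) : ℝ := ∑ u, f u * chi σ w u

/-- The squared transform is dual to autocorrelation; Parseval is the case `s = 0`. In
characteristic two the characters are real and signs of group elements do not matter. -/
theorem sum_hat_sq_mul_chi [CharP F 2] (h : IsSignChar σ) (f : F × F × F → ℝ) (s : F × F × F) :
    ∑ w, hat σ f w ^ 2 * chi σ w s = (Fintype.card F : ℝ) ^ 3 * ∑ u, f u * f (u + s) := by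
  have h1 : ∀ w, hat σ f w ^ 2 * chi σ w s = ∑ u, ∑ v, f u * f v * chi σ w (u + v + s) := by
    intro w
    rw [sq, hat, Finset.sum_mul_sum, Finset.sum_mul]
    refine Finset.sum_congr rfl fun u _ => ?_
    rw [Finset.sum_mul]
    refine Finset.sum_congr rfl fun v _ => ?_
    rw [chi_add h, chi_add h]; ring
  simp only [h1]
  rw [Finset.sum_comm, Finset.mul_sum]
  refine Finset.sum_congr rfl fun u _ => ?_
  rw [Finset.sum_comm]
  simp only [← Finset.mul_sum, sum_chi h]
  have h2 : ∀ v, u + v + s = 0 ↔ v = u + s := by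
    intro v
    have hs : ∀ z : F × F × F, z + z = 0 := fun z => by
      obtain ⟨a, b, c⟩ := z
      simp only [Prod.mk_add_mk, CharTwo.add_self_eq_zero]; rfl
    constructor
    · intro h0
      have : v = (u + v + s) + (u + s) - (u + u) - (s + s) := by abel
      rw [this, h0, hs, hs]; simp
    · rintro rfl
      have : u + (u + s) + s = (u + u) + (s + s) := by abel
      rw [this, hs, hs]; simp
  simp only [h2, mul_ite, mul_zero, Finset.sum_ite_eq', Finset.mem_univ, if_true]
  ring

/-- These sums are the eigenvalues. Summing over `x` first, each nonzero `y` gives q/2 if `g y = 0`,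
-q/2 if `1 + g y = 0`, and 0 otherwise. The polynomial 1 + g has degree at most 3 and constant term
1, so it has at most three roots. -/
theorem sum_chi_curve_ge (h : IsSignChar σ) (w : F × F × F) :
    -(3 / 2 * (Fintype.card F : ℝ)) ≤ ∑ p ∈ genIndex σ, chi σ w (curve p) := by
  set q : ℝ := (Fintype.card F : ℝ) with hq
  have hq0 : 0 ≤ q := Nat.cast_nonneg _
  set g : F → F := fun y => w.1 * y + w.2.1 * y ^ 2 + w.2.2 * y ^ 3 with hg
  have e1 : ∑ p ∈ genIndex σ, chi σ w (curve p) =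
      ∑ y, if y ≠ 0 then (∑ x, (1 - σ x) / 2 * σ (x * g y)) else 0 := by
    rw [genIndex, Finset.sum_filter, Fintype.sum_prod_type, Finset.sum_comm]
    refine Finset.sum_congr rfl fun y _ => ?_
    by_cases hy : y = 0
    · simp [hy]
    · rw [if_pos hy]
      refine Finset.sum_congr rfl fun x _ => ?_
      have e2 : chi σ w (curve (x, y)) = σ (x * g y) := by
        simp only [chi, curve, hg]; congr 1; ring
      rw [e2]
      rcases h.sign x with hx | hx
      · rw [hx]; norm_num
      · simp [hx, hy]
  have e3 : ∀ y, ∑ x, (1 - σ x) / 2 * σ (x * g y) =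
      q / 2 * (if g y = 0 then 1 else 0) - q / 2 * (if 1 + g y = 0 then 1 else 0) := by
    intro y
    have : ∀ x, (1 - σ x) / 2 * σ (x * g y) = σ (x * g y) / 2 - σ (x * (1 + g y)) / 2 := by
      intro x
      rw [mul_add x 1, mul_one, h.add]; ring
    simp only [this, Finset.sum_sub_distrib, ← Finset.sum_div, h.sum_mul]
    split_ifs <;> simp [hq]
  have e4 : ∀ y, -(q / 2 * (if 1 + g y = 0 then 1 else 0)) ≤
      if y ≠ 0 then (∑ x, (1 - σ x) / 2 * σ (x * g y)) else 0 := by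
    intro y
    rw [e3]
    split_ifs <;> linarith
  have e5 : ((Finset.univ.filter fun y => 1 + g y = 0).card : ℝ) ≤ 3 := by
    set P : Polynomial F := Polynomial.C w.2.2 * Polynomial.X ^ 3 + Polynomial.C w.2.1 *
      Polynomial.X ^ 2 + Polynomial.C w.1 * Polynomial.X + Polynomial.C 1 with hP
    have hP0 : P ≠ 0 := by
      intro h0
      have := congrArg (Polynomial.eval 0) h0
      simp [hP] at this
    have hsub : (Finset.univ.filter fun y => 1 + g y = 0) ⊆ P.roots.toFinset := by
      intro y hy
      rw [Multiset.mem_toFinset, Polynomial.mem_roots hP0, Polynomial.IsRoot]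
      have := (Finset.mem_filter.1 hy).2
      rw [← this]
      simp only [hP, hg, Polynomial.eval_add, Polynomial.eval_mul, Polynomial.eval_C,
        Polynomial.eval_pow, Polynomial.eval_X]
      ring
    have := (Finset.card_le_card hsub).trans ((Multiset.toFinset_card_le _).trans
      ((Polynomial.card_roots' P).trans Polynomial.natDegree_cubic_le))
    exact_mod_cast this
  rw [e1]
  calc -(3 / 2 * q) ≤ -(q / 2 * (Finset.univ.filter fun y => 1 + g y = 0).card) := by nlinarith
    _ = ∑ y, -(q / 2 * (if 1 + g y = 0 then 1 else 0)) := by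
        rw [Finset.sum_neg_distrib, ← Finset.mul_sum, Finset.sum_boole]
    _ ≤ _ := Finset.sum_le_sum fun y _ => e4 y

theorem quad_cayley_ge [CharP F 2] (h : IsSignChar σ) (f : F × F × F → ℝ) :
    -(3 / 2 * (Fintype.card F : ℝ)) * ∑ u, f u ^ 2 ≤ quad (cayley h) f := by
  have hq : (0 : ℝ) < (Fintype.card F : ℝ) ^ 3 := by
    have : 0 < Fintype.card F := Fintype.card_pos
    positivity
  have e1 : quad (cayley h) f = ∑ p ∈ genIndex σ, ∑ u, f u * f (u + curve p) := by
    rw [Finset.sum_comm]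
    refine Finset.sum_congr rfl fun u _ => ?_
    rw [← sum_adjR_cayley h u fun v => f u * f v]
  have e2 : (Fintype.card F : ℝ) ^ 3 * quad (cayley h) f =
      ∑ w, hat σ f w ^ 2 * ∑ p ∈ genIndex σ, chi σ w (curve p) := by
    rw [e1, Finset.mul_sum]
    simp only [← sum_hat_sq_mul_chi h, Finset.mul_sum]
    exact Finset.sum_comm
  have e3 : ∑ w, hat σ f w ^ 2 = (Fintype.card F : ℝ) ^ 3 * ∑ u, f u ^ 2 := by
    have := sum_hat_sq_mul_chi h f 0
    simp only [add_zero] at this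
    have hc : ∀ w, chi σ w 0 = 1 := fun w => by simp [chi, h.zero]
    simp only [hc, mul_one] at this
    rw [this]
    simp only [sq]
  refine le_of_mul_le_mul_left ?_ hq
  rw [e2]
  calc _ = ∑ w, hat σ f w ^ 2 * -(3 / 2 * (Fintype.card F : ℝ)) := by
        rw [← Finset.sum_mul, e3]; ring
    _ ≤ _ := Finset.sum_le_sum fun w _ =>
        mul_le_mul_of_nonneg_left (sum_chi_curve_ge h w) (sq_nonneg _)

theorem card_genIndex (h : IsSignChar σ) :
    2 * ((genIndex σ).card : ℝ) = Fintype.card F * (Fintype.card F - 1) := by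
  have e1 : ((genIndex σ).card : ℝ) =
      ∑ x, ∑ y : F, (1 - σ x) / 2 * (if y ≠ 0 then 1 else 0) := by
    rw [genIndex, Finset.card_filter, Fintype.sum_prod_type]
    push_cast
    refine Finset.sum_congr rfl fun x _ => Finset.sum_congr rfl fun y _ => ?_
    rcases h.sign x with hx | hx
    · rw [hx]; norm_num
    · by_cases hy : y = 0 <;> simp [hx, hy]
  have e2 : ∑ y : F, (if y ≠ 0 then (1 : ℝ) else 0) = Fintype.card F - 1 := by
    have : ∀ y : F, (if y ≠ 0 then (1 : ℝ) else 0) = 1 - if y = 0 then 1 else 0 := by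
      intro y; split_ifs <;> simp_all
    simp only [this, Finset.sum_sub_distrib]
    simp
  have e3 : ∑ x, σ x = 0 := by simpa using h.sum_mul 1
  simp only [← Finset.mul_sum, e2, ← Finset.sum_mul] at e1
  rw [e1, ← Finset.sum_div, Finset.sum_sub_distrib, e3]
  simp
  ring

end Fourier

end Cayley

/-! ### Triangle-free graphs with every number of edges -/

theorem adjR_congr {V V' : Type*} {G : SimpleGraph V} {G' : SimpleGraph V'} {u v : V} {u' v' : V'}
    (h : G.Adj u v ↔ G'.Adj u' v') : adjR G u v = adjR G' u' v' := by
  by_cases hA : G.Adj u v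
  · rw [adjR_of_adj hA, adjR_of_adj (h.1 hA)]
  · rw [adjR_of_not_adj hA, adjR_of_not_adj fun h' => hA (h.2 h')]

/-- There is a triangle-free graph with `m` edges and surplus at most `B`. -/
def HasTriangleFree (m : ℕ) (B : ℝ) : Prop :=
  ∃ (V : Type) (_ : Fintype V) (G : SimpleGraph V),
    (∀ a b c, G.Adj a b → G.Adj b c → G.Adj a c → False) ∧ G.edgeSet.ncard = m ∧
      ∀ s : V → ℝ, (∀ v, s v = 1 ∨ s v = -1) → -quad G s / 4 ≤ B

theorem HasTriangleFree.mono {m : ℕ} {B B' : ℝ} (h : HasTriangleFree m B) (hB : B ≤ B') :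
    HasTriangleFree m B' := by
  obtain ⟨V, i, G, h1, h2, h3⟩ := h
  exact ⟨V, i, G, h1, h2, fun s hs => (h3 s hs).trans hB⟩

theorem hasTriangleFree_zero : HasTriangleFree 0 0 :=
  ⟨Empty, inferInstance, ⊥, fun a => a.elim, by simp, fun s _ => by simp [quad]⟩

theorem hasTriangleFree_one : HasTriangleFree 1 1 := by
  refine ⟨Bool, inferInstance, ⊤, ?_, ?_, ?_⟩
  · intro a b c hab hbc hac
    simp only [SimpleGraph.top_adj] at hab hbc hac
    cases a <;> cases b <;> cases c <;> simp_all
  · have h := sum_adjR (⊤ : SimpleGraph Bool)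
    generalize (⊤ : SimpleGraph Bool).edgeSet.ncard = n at h ⊢
    simp only [Fintype.sum_bool, adjR, SimpleGraph.top_adj] at h
    norm_num at h
    exact h
  · intro s hs
    simp only [quad, Fintype.sum_bool, adjR]
    rcases hs true with h1 | h1 <;> rcases hs false with h2 | h2 <;> simp [h1, h2] <;> norm_num

theorem HasTriangleFree.add {m m' : ℕ} {B B' : ℝ} (h : HasTriangleFree m B)
    (h' : HasTriangleFree m' B') : HasTriangleFree (m + m') (B + B') := by
  obtain ⟨V, i, G, h1, h2, h3⟩ := h
  obtain ⟨V', i', G', h1', h2', h3'⟩ := h'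
  have ell : ∀ a b, adjR (G ⊕g G') (Sum.inl a) (Sum.inl b) = adjR G a b :=
    fun a b => adjR_congr SimpleGraph.sum_adj_inl
  have err : ∀ a b, adjR (G ⊕g G') (Sum.inr a) (Sum.inr b) = adjR G' a b :=
    fun a b => adjR_congr SimpleGraph.sum_adj_inr
  have elr : ∀ a b, adjR (G ⊕g G') (Sum.inl a) (Sum.inr b) = 0 := by
    intro a b; simp [adjR]
  have erl : ∀ a b, adjR (G ⊕g G') (Sum.inr a) (Sum.inl b) = 0 := by
    intro a b; simp [adjR]
  refine ⟨V ⊕ V', inferInstance, G ⊕g G', ?_, ?_, ?_⟩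
  · rintro (a | a) (b | b) (c | c) hab hbc hac <;> simp at hab hbc hac
    · exact h1 a b c hab hbc hac
    · exact h1' a b c hab hbc hac
  · have e := sum_adjR (G ⊕g G')
    simp only [Fintype.sum_sum_type, ell, err, elr, erl, Finset.sum_const_zero, add_zero,
      zero_add] at e
    rw [sum_adjR, sum_adjR, h2, h2'] at e
    have : ((G ⊕g G').edgeSet.ncard : ℝ) = ((m + m' : ℕ) : ℝ) := by push_cast; linarith
    exact_mod_cast this
  · intro s hs
    have e : quad (G ⊕g G') s = quad G (fun v => s (Sum.inl v)) + quad G' fun v => s (Sum.inr v) := by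
      simp only [quad, Fintype.sum_sum_type, ell, err, elr, erl, zero_mul, Finset.sum_const_zero,
        add_zero, zero_add]
    have := h3 _ fun v => hs (Sum.inl v)
    have := h3' _ fun v => hs (Sum.inr v)
    rw [e]
    linarith

/-- The number of edges of the Cayley graph over the field with `2 ^ (j + 1)` elements. -/
def cayleyEdges (j : ℕ) : ℕ := 2 ^ (4 * j + 2) * (2 ^ (j + 1) - 1)

theorem cast_cayleyEdges (j : ℕ) : (cayleyEdges j : ℝ) =
    ((2 : ℝ) ^ (j + 1)) ^ 4 * ((2 : ℝ) ^ (j + 1) - 1) / 4 := by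
  unfold cayleyEdges
  rw [Nat.cast_mul, Nat.cast_sub Nat.one_le_two_pow]
  push_cast
  ring

theorem cayleyEdges_succ_le (j : ℕ) : cayleyEdges (j + 1) ≤ 64 * cayleyEdges j := by
  have h : (cayleyEdges (j + 1) : ℝ) ≤ ((64 * cayleyEdges j : ℕ) : ℝ) := by
    push_cast
    rw [cast_cayleyEdges, cast_cayleyEdges, pow_succ (2 : ℝ) (j + 1)]
    have h1 : (2 : ℝ) ≤ 2 ^ (j + 1) := by
      have := pow_le_pow_right₀ (one_le_two : (1 : ℝ) ≤ 2) (Nat.le_add_left 1 j)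
      simpa using this
    set y : ℝ := 2 ^ (j + 1)
    have : 0 ≤ y ^ 4 := by positivity
    nlinarith
  exact_mod_cast h

/-- There are q³ vertices of degree q(q-1)/2. The eigenvalue bound gives surplus at most 3q⁴/8, and
`q ≥ 2` gives q⁵ ≤ 8e for e edges, hence q⁴ ≤ 8e^{4/5}. -/
theorem hasTriangleFree_cayleyEdges (j : ℕ) :
    HasTriangleFree (cayleyEdges j) (3 * (cayleyEdges j : ℝ) ^ (4 / 5 : ℝ)) := by
  classical
  let F := GaloisField 2 (j + 1)
  let _ : Fintype F := Fintype.ofFinite F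
  have hcard : (Fintype.card F : ℝ) = 2 ^ (j + 1) := by
    rw [Fintype.card_eq_nat_card, GaloisField.card 2 (j + 1) (Nat.succ_ne_zero j)]
    push_cast; rfl
  set q : ℝ := 2 ^ (j + 1) with hq
  have hq2 : (2 : ℝ) ≤ q := by
    have := pow_le_pow_right₀ (one_le_two : (1 : ℝ) ≤ 2) (Nat.le_add_left 1 j)
    simpa using this
  obtain ⟨σ, h⟩ := exists_isSignChar F
  refine ⟨F × F × F, inferInstance, cayley h, cayley_triangle_free h, ?_, ?_⟩
  · have e := sum_adjR (cayley h)
    have e1 : ∀ u, ∑ v, adjR (cayley h) u v = (genIndex σ).card := by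
      intro u
      have := sum_adjR_cayley h u fun _ => 1
      simpa using this
    have e2 := card_genIndex h
    simp only [e1, Finset.sum_const, Finset.card_univ, Fintype.card_prod, nsmul_eq_mul] at e
    push_cast at e
    rw [hcard] at e e2
    have e3 : ((cayley h).edgeSet.ncard : ℝ) = cayleyEdges j := by
      rw [cast_cayleyEdges, ← hq]
      linear_combination (-1 / 2) * e + (1 / 4) * q ^ 3 * e2
    exact_mod_cast e3
  · intro s hs
    have e1 := quad_cayley_ge h s
    have e2 : ∑ u, s u ^ 2 = q ^ 3 := by
      have : ∀ u, s u ^ 2 = 1 := fun u => by rcases hs u with h | h <;> rw [h] <;> norm_num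
      simp only [this, Finset.sum_const, Finset.card_univ, Fintype.card_prod, nsmul_eq_mul, mul_one]
      push_cast
      rw [hcard]; ring
    rw [e2, hcard] at e1
    have e3 : q ^ 5 ≤ 8 * cayleyEdges j := by
      rw [cast_cayleyEdges, ← hq]
      have : 0 ≤ q ^ 4 := by positivity
      nlinarith
    have e4 : q ^ 4 ≤ 8 * (cayleyEdges j : ℝ) ^ (4 / 5 : ℝ) := by
      have h1 : q ^ 4 = (q ^ 5) ^ (4 / 5 : ℝ) := by
        rw [← Real.rpow_natCast q 5, ← Real.rpow_mul (by linarith), ← Real.rpow_natCast]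
        norm_num
      rw [h1]
      calc (q ^ 5) ^ (4 / 5 : ℝ) ≤ (8 * cayleyEdges j : ℝ) ^ (4 / 5 : ℝ) :=
            Real.rpow_le_rpow (by positivity) e3 (by norm_num)
        _ = 8 ^ (4 / 5 : ℝ) * (cayleyEdges j : ℝ) ^ (4 / 5 : ℝ) :=
            Real.mul_rpow (by norm_num) (Nat.cast_nonneg _)
        _ ≤ 8 * (cayleyEdges j : ℝ) ^ (4 / 5 : ℝ) := by
            refine mul_le_mul_of_nonneg_right ?_ (Real.rpow_nonneg (Nat.cast_nonneg _) _)
            exact Real.rpow_le_self_of_one_le (by norm_num) (by norm_num)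
    nlinarith

/-- Take the Cayley graph just before the edge count first exceeds `m`; consecutive counts differ by
a factor of at most 64. Below 4, the smallest such count, a single edge serves. -/
theorem exists_hasTriangleFree_piece (m : ℕ) (hm : 1 ≤ m) : ∃ e : ℕ, 1 ≤ e ∧ e ≤ m ∧ m ≤ 64 * e ∧
    HasTriangleFree e (3 * (e : ℝ) ^ (4 / 5 : ℝ)) := by
  by_cases hm4 : m < 4
  · exact ⟨1, le_refl _, hm, by omega, hasTriangleFree_one.mono (by norm_num)⟩
  · have hex : ∃ j, m < cayleyEdges j := by
      refine ⟨m, ?_⟩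
      calc m < 2 ^ m := Nat.lt_two_pow_self
        _ ≤ 2 ^ (4 * m + 2) := Nat.pow_le_pow_right (by norm_num) (by omega)
        _ = 2 ^ (4 * m + 2) * 1 := (mul_one _).symm
        _ ≤ cayleyEdges m := by
          refine Nat.mul_le_mul_left _ ?_
          have : 2 ^ 1 ≤ 2 ^ (m + 1) := Nat.pow_le_pow_right (by norm_num) (by omega)
          omega
    have h1 := Nat.find_spec hex
    have h0 : Nat.find hex ≠ 0 := by
      intro h0
      rw [h0] at h1
      have : cayleyEdges 0 = 4 := rfl
      omega
    obtain ⟨n, hn⟩ := Nat.exists_eq_succ_of_ne_zero h0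
    have h2 := Nat.find_min hex (m := n) (by omega)
    rw [hn, Nat.succ_eq_add_one] at h1
    have h3 := cayleyEdges_succ_le n
    refine ⟨cayleyEdges n, ?_, by omega, by omega, hasTriangleFree_cayleyEdges n⟩
    omega

/-- With x = e/m, Bernoulli bounds the second term by 12 - 48x/5 in units of m^{4/5}, and the first
is at most 9x because x ≥ 1/64 > 3⁻⁵. The constant 12 thus survives the induction that peels off one
piece at a time. -/
theorem rpow_four_fifths_split {m e : ℝ} (he : 0 < e) (hem : e ≤ m) (hme : m ≤ 64 * e) :
    3 * e ^ (4 / 5 : ℝ) + 12 * (m - e) ^ (4 / 5 : ℝ) ≤ 12 * m ^ (4 / 5 : ℝ) := by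
  have hm : 0 < m := by linarith
  set x : ℝ := e / m with hx
  have hx0 : 0 < x := div_pos he hm
  have hx1 : x ≤ 1 := (div_le_one hm).2 hem
  have hx64 : 1 / 64 ≤ x := by
    rw [hx, div_le_div_iff₀ (by norm_num) hm]; linarith
  have e1 : e = m * x := by rw [hx]; field_simp
  have e2 : m - e = m * (1 + -x) := by rw [e1]; ring
  rw [e2]
  nth_rewrite 1 [e1]
  rw [Real.mul_rpow hm.le hx0.le, Real.mul_rpow hm.le (by linarith)]
  have h1 : (1 + -x) ^ (4 / 5 : ℝ) ≤ 1 + 4 / 5 * -x :=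
    rpow_one_add_le_one_add_mul_self (by linarith) (by norm_num) (by norm_num)
  have h2 : x ^ (4 / 5 : ℝ) ≤ 3 * x := by
    set z : ℝ := x ^ (1 / 5 : ℝ) with hz
    have hz0 : 0 < z := Real.rpow_pos_of_pos hx0 _
    have hz5 : z ^ 5 = x := by
      rw [hz, ← Real.rpow_natCast, ← Real.rpow_mul hx0.le]; norm_num
    have hz4 : x ^ (4 / 5 : ℝ) = z ^ 4 := by
      rw [hz, ← Real.rpow_natCast, ← Real.rpow_mul hx0.le]; norm_num
    have hz3 : 1 / 3 ≤ z := by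
      by_contra! hlt
      have := pow_lt_pow_left₀ hlt hz0.le (n := 5) (by norm_num)
      rw [hz5] at this
      norm_num at this
      linarith
    rw [hz4, ← hz5]
    have : 0 < z ^ 4 := by positivity
    nlinarith
  have h3 : 0 ≤ m ^ (4 / 5 : ℝ) := Real.rpow_nonneg hm.le _
  nlinarith

theorem hasTriangleFree_rpow (m : ℕ) : HasTriangleFree m (12 * (m : ℝ) ^ (4 / 5 : ℝ)) := by
  induction m using Nat.strong_induction_on with
  | _ m ih =>
    rcases Nat.eq_zero_or_pos m with rfl | hm
    · exact hasTriangleFree_zero.mono (by positivity)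
    · obtain ⟨e, he, hem, hme, h⟩ := exists_hasTriangleFree_piece m hm
      have h1 := h.add (ih (m - e) (by omega))
      rw [Nat.add_sub_cancel' hem] at h1
      refine h1.mono ?_
      rw [Nat.cast_sub hem]
      exact rpow_four_fifths_split (by exact_mod_cast he) (by exact_mod_cast hem)
        (by exact_mod_cast hme)

/-! ### Passage to `H`-free graphs and conclusion -/

/-- Stars show that there are `H`-free graphs with any number of edges. -/
theorem surplusValues_nonempty {W : Type*} (t k : ℕ) (ht : 1 ≤ t) (hk : 2 ≤ k)
    (H : SimpleGraph W) (hH : ∃ v : W, Nonempty (H.induce ({v}ᶜ : Set W) ≃g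
      disjointCopies t (SimpleGraph.cycleGraph (2 * k)))) (m : ℕ) :
    (surplusValues m H).Nonempty := by
  let G : SimpleGraph (Fin (m + 1)) :=
    { Adj := fun i j => (i = 0 ∧ j ≠ 0) ∨ (j = 0 ∧ i ≠ 0)
      symm := ⟨fun i j h => h.symm⟩
      loopless := ⟨fun i h => by rcases h with h | h <;> exact h.2 h.1⟩ }
  refine ⟨_, m + 1, G, ?_, ?_, rfl⟩
  · rintro ⟨f⟩
    obtain ⟨v, ⟨e⟩⟩ := hH
    let c : ℕ → Fin t × Fin (2 * k) := fun i => (⟨0, ht⟩, ⟨i % (2 * k), Nat.mod_lt _ (by omega)⟩)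
    have hc : ∀ i < 4, ∀ j < 4, c i = c j → i = j := by
      intro i hi j hj h
      simp only [c, Prod.mk.injEq, Fin.mk.injEq, true_and] at h
      rwa [Nat.mod_eq_of_lt (by omega), Nat.mod_eq_of_lt (by omega)] at h
    let g : ℕ → Fin (m + 1) := fun i => f (e.symm (c i)).1
    have hg : ∀ i < 4, ∀ j < 4, g i = g j → i = j := by
      intro i hi j hj h
      exact hc i hi j hj (e.symm.injective (Subtype.ext (f.injective h)))
    have hadj : ∀ i, i + 1 < 4 → G.Adj (g i) (g (i + 1)) := by
      intro i hi
      refine f.toHom.map_adj ?_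
      have : (H.induce ({v}ᶜ : Set W)).Adj (e.symm (c i)) (e.symm (c (i + 1))) := by
        rw [e.symm.map_adj_iff]
        refine ⟨rfl, ?_⟩
        rw [SimpleGraph.cycleGraph_adj']
        right
        rw [Fin.sub_def]
        simp only [c]
        rw [Nat.mod_eq_of_lt (show i + 1 < 2 * k by omega),
          Nat.mod_eq_of_lt (show i < 2 * k by omega),
          show 2 * k - i + (i + 1) = 1 + 2 * k by omega, Nat.add_mod_right,
          Nat.mod_eq_of_lt (by omega)]
      exact this
    -- Two disjoint edges of a cycle would both have to contain the centre of the star.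
    have h01 := hadj 0 (by norm_num)
    have h23 := hadj 2 (by norm_num)
    have hz : ∃ i < 2, g i = 0 := by
      rcases h01 with h | h
      · exact ⟨0, by norm_num, h.1⟩
      · exact ⟨1, by norm_num, h.1⟩
    have hz' : ∃ i, 2 ≤ i ∧ i < 4 ∧ g i = 0 := by
      rcases h23 with h | h
      · exact ⟨2, by norm_num, by norm_num, h.1⟩
      · exact ⟨3, by norm_num, by norm_num, h.1⟩
    obtain ⟨i, hi, hi0⟩ := hz
    obtain ⟨j, hj2, hj4, hj0⟩ := hz'
    have := hg i (by omega) j hj4 (hi0.trans hj0.symm)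
    omega
  · have h := sum_adjR G
    have h0 : adjR G 0 0 = 0 := adjR_self _ _
    have h1 : ∀ i : Fin m, adjR G 0 i.succ = 1 := fun i => adjR_of_adj (Or.inl ⟨rfl, by simp⟩)
    have h2 : ∀ i : Fin m, adjR G i.succ 0 = 1 := fun i => adjR_of_adj (Or.inr ⟨rfl, by simp⟩)
    have h3 : ∀ i j : Fin m, adjR G i.succ j.succ = 0 := fun i j => adjR_of_not_adj (by
      rintro (h | h) <;> simp at h)
    simp only [Fin.sum_univ_succ, h0, h1, h2, h3] at h
    simp at h
    have : (G.edgeSet.ncard : ℝ) = m := by linarith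
    exact_mod_cast this

theorem exists_mem_surplusValues_le {W : Type*} (H : SimpleGraph W)
    (hH : (SimpleGraph.completeGraph (Fin 3)).IsContained H) {m : ℕ} {B : ℝ}
    (h : HasTriangleFree m B) : ∃ x ∈ surplusValues m H, x ≤ B := by
  obtain ⟨V, i, G, h1, h2, h3⟩ := h
  let e := Fintype.equivFin V
  let G' : SimpleGraph (Fin (Fintype.card V)) := G.comap e.symm
  have hadj : ∀ a b, adjR G' (e a) (e b) = adjR G a b :=
    fun a b => adjR_congr (by simp [G'])
  refine ⟨surplus G', ⟨_, G', ?_, ?_, rfl⟩, ?_⟩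
  · intro hc
    obtain ⟨f⟩ := hH.trans hc
    have hf : ∀ a b : Fin 3, a ≠ b → G.Adj (e.symm (f a)) (e.symm (f b)) := by
      intro a b hab
      exact f.toHom.map_adj hab
    exact h1 _ _ _ (hf 0 1 (by decide)) (hf 1 2 (by decide)) (hf 0 2 (by decide))
  · have e1 := sum_adjR G'
    rw [← e.sum_comp] at e1
    simp only [← e.sum_comp (fun b => adjR G' _ b), hadj] at e1
    rw [sum_adjR, h2] at e1
    have : (G'.edgeSet.ncard : ℝ) = m := by linarith
    exact_mod_cast this
  · refine surplus_le_of_sign G' B fun s hs => ?_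
    have e1 : quad G' s = quad G fun v => s (e v) := by
      unfold quad
      rw [← e.sum_comp]
      refine Finset.sum_congr rfl fun a _ => ?_
      rw [← e.sum_comp]
      simp only [hadj]
    rw [e1]
    exact h3 _ fun v => hs (e v)

end SurplusFree

theorem mainTheorem7 {V : Type*} [Fintype V] (t k : ℕ) (ht : 1 ≤ t) (hk : 2 ≤ k)
    (H : SimpleGraph V)
    (hH : ∃ v : V, Nonempty (H.induce ({v}ᶜ : Set V) ≃g
      SurplusFree.disjointCopies t (SimpleGraph.cycleGraph (2 * k)))) :
    (∃ c : ℝ, 0 < c ∧ ∀ m : ℕ, 1 ≤ m →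
      c * (m : ℝ) ^ (4 / 5 : ℝ) ≤ SurplusFree.minSurplus m H) ∧
    ((SimpleGraph.completeGraph (Fin 3)).IsContained H →
      ∃ C : ℝ, 0 < C ∧ ∀ m : ℕ, 1 ≤ m →
        SurplusFree.minSurplus m H ≤ C * (m : ℝ) ^ (4 / 5 : ℝ)) := by
  -- Nonemptiness matters: the real infimum of an empty set is 0 by default.
  have hleast := fun m => SurplusFree.minSurplus_isLeast m H
    (SurplusFree.surplusValues_nonempty t k ht hk H hH m)
  constructor
  · obtain ⟨c, hc, hcm⟩ := SurplusFree.exists_surplus_ge_of_locallySparse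
      ((t * k + 1 : ℕ) * 3 : ℝ) (by positivity)
    refine ⟨c, hc, fun m hm => ?_⟩
    obtain ⟨n, G, hG, hGm, hGs⟩ := (hleast m).1
    rw [← hGs, ← hGm]
    exact hcm _ G (fun w S hS => SurplusFree.sum_adjR_le_of_free t k hk H hH G hG w S hS)
      (hGm ▸ hm)
  · intro htri
    refine ⟨12, by norm_num, fun m _ => ?_⟩
    obtain ⟨x, hx, hxB⟩ := SurplusFree.exists_mem_surplusValues_le H htri
      (SurplusFree.hasTriangleFree_rpow m)
    exact ((hleast m).2 hx).trans hxB
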